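/- Let $\Gamma$ be a finitely generated hyperbolic group, let $\Lambda$ be a finitely generated group, and let $p>q>0$ be real numbers. Put $\varphi(t)=\exp(t^p)$ and $\psi(t)=t^{1+1/q}$ for $t\ge 0$. If there is a cobounded $(\varphi,\psi)$-integrable measure equivalence coupling from $\Gamma$ to $\Lambda$, then $\Lambda$ is hyperbolic. Here a finitely generated group is hyperbolic if its Cayley graph with respect to a finite generating set, with edges of length one and the path metric, is a hyperbolic geodesic space, that is, for some $\delta\ge 0$ each side of each geodesic triangle lies in the $\delta$-neighbourhood of the union of the other two sides. A measure equivalence coupling from $\Gamma$ to $\Lambda$ is a quadruple $(\Omega,X_\Gamma,X_\Lambda,\mu)$, where $\Omega$ is a standard Borel space with a nonzero $\sigma$-finite measure $\mu$, equipped with commuting, measure-preserving, (essentially) free Borel actions of $\Gamma$ and $\Lambda$, and $X_\Gamma$, $X_\Lambda\subseteq\Omega$ are Borel fundamental domains of finite measure for the actions of $\Gamma$ and $\Lambda$, that is, $X_\Gamma$ (resp. $X_\Lambda$) meets almost every $\Gamma$-orbit (resp. $\Lambda$-orbit) in exactly one point. For $\gamma\in\Gamma$ and almost every $x\in X_\Lambda$,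 let $\alpha(\gamma,x)$ be the unique element of $\Lambda$ with $\alpha(\gamma,x)\gamma x\in X_\Lambda$; for $\lambda\in\Lambda$ and almost every $x\in X_\Gamma$, let $\beta(\lambda,x)$ be the unique element of $\Gamma$ with $\beta(\lambda,x)\lambda x\in X_\Gamma$. Let $|\cdot|$ denote word lengths with respect to finite generating sets of $\Lambda$ and $\Gamma$. The coupling is $(\varphi,\psi)$-integrable if for every $\gamma\in\Gamma$ there is $c>0$ with $\int_{X_\Lambda}\varphi(|\alpha(\gamma,x)|/c)\,d\mu(x)<\infty$, and for every $\lambda\in\Lambda$ there is $c>0$ with $\int_{X_\Gamma}\psi(|\beta(\lambda,x)|/c)\,d\mu(x)<\infty$. It is cobounded if there is a finite set $F\subseteq\Lambda$ with $X_\Gamma\subseteq F X_\Lambda$. -/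

import Mathlib

open MeasureTheory Set
open scoped Pointwise ENNReal

noncomputable section

/-! ### Geodesics and Rips hyperbolicity -/

/-- `A` is (the image of) a geodesic from `a` to `b`. -/
def IsGeodesicSegment {X : Type*} [PseudoMetricSpace X] (a b : X) (A : Set X) : Prop :=
  ∃ c : ℝ → X, c 0 = a ∧ c (dist a b) = b ∧
    (∀ s ∈ Icc 0 (dist a b), ∀ t ∈ Icc 0 (dist a b), dist (c s) (c t) = |s - t|) ∧
    A = c '' Icc 0 (dist a b)

/-- Any two points are joined by a geodesic. -/
def IsGeodesicSpace (X : Type*) [PseudoMetricSpace X] : Prop :=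
  ∀ a b : X, ∃ A : Set X, IsGeodesicSegment a b A

/-- Every side of every geodesic triangle lies in the `δ`-neighbourhood of the two others. -/
def HasSlimTriangles (X : Type*) [PseudoMetricSpace X] (δ : ℝ) : Prop :=
  ∀ (a₁ a₂ a₃ : X) (A₁₂ A₁₃ A₂₃ : Set X),
    IsGeodesicSegment a₁ a₂ A₁₂ → IsGeodesicSegment a₁ a₃ A₁₃ → IsGeodesicSegment a₂ a₃ A₂₃ →
    ∀ x ∈ A₁₂, ∃ y ∈ A₁₃ ∪ A₂₃, dist x y ≤ δ

/-- A geodesic space that is `δ`-hyperbolic in the sense of Rips for some `δ ≥ 0`. -/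
def IsRipsHyperbolic (X : Type*) [PseudoMetricSpace X] : Prop :=
  IsGeodesicSpace X ∧ ∃ δ : ℝ, 0 ≤ δ ∧ HasSlimTriangles X δ

/-! ### A connected graph as a metric space with edges of length one -/

/-- A parametrized point of the geometric realization of a connected graph `G`: the point at
parameter `t` on the edge from `u` to `v`. If `u = v` it stands for the vertex `u`. The same point
has several parametrizations; they are at distance `0` and are identified in
`GraphRealization`. -/
structure GraphPoint {V : Type*} (G : SimpleGraph V) (hG : G.Connected) where
  /-- the starting vertex -/
  u : V
  /-- the end vertex -/
  v : V
  /-- the two vertices span an edge, or coincide -/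
  edge : u = v ∨ G.Adj u v
  /-- the parameter on the edge -/
  t : ℝ
  /-- the parameter lies in the unit interval -/
  ht : t ∈ Icc (0 : ℝ) 1

namespace GraphPoint

variable {V : Type*} {G : SimpleGraph V} {hG : G.Connected}

/-- The length of the edge carrying the point: `1`, or `0` if the edge is degenerate. -/
def len (p : GraphPoint G hG) : ℝ := G.dist p.u p.v

/-- The distance from a point to a vertex: a path from the point leaves its edge through one of
the two end points. -/
def distVertex (p : GraphPoint G hG) (w : V) : ℝ :=
  min (p.t * p.len + G.dist p.u w) ((1 - p.t) * p.len + G.dist p.v w)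

open Classical in
/-- The path metric. On a common edge this is the distance of the unit interval; otherwise a
path ends by entering the edge of `q` through one of its two end points. -/
def pathDist (p q : GraphPoint G hG) : ℝ :=
  if p.u = q.u ∧ p.v = q.v then |p.t - q.t| * p.len
  else if p.u = q.v ∧ p.v = q.u then |p.t - (1 - q.t)| * p.len
  else min (p.distVertex q.u + q.t * q.len) (p.distVertex q.v + (1 - q.t) * q.len)

/-- The two points are carried by the same (unoriented) edge. -/
def SameEdge (p q : GraphPoint G hG) : Prop :=
  (p.u = q.u ∧ p.v = q.v) ∨ (p.u = q.v ∧ p.v = q.u)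

theorem len_nonneg (p : GraphPoint G hG) : 0 ≤ p.len := Nat.cast_nonneg _

theorem tri (hG : G.Connected) (a b c : V) :
    (G.dist a c : ℝ) ≤ G.dist a b + G.dist b c := by
  exact_mod_cast hG.dist_triangle

theorem dcomm (a b : V) : (G.dist a b : ℝ) = G.dist b a := by
  rw [SimpleGraph.dist_comm]

theorem tl_nonneg (p : GraphPoint G hG) : 0 ≤ p.t * p.len :=
  mul_nonneg p.ht.1 p.len_nonneg

theorem tl_nonneg' (p : GraphPoint G hG) : 0 ≤ (1 - p.t) * p.len :=
  mul_nonneg (by linarith [p.ht.2]) p.len_nonneg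

theorem distVertex_le (p : GraphPoint G hG) (w w' : V) :
    p.distVertex w ≤ p.distVertex w' + G.dist w' w := by
  unfold distVertex
  rw [← min_add_add_right]
  refine min_le_min ?_ ?_
  · linarith [tri hG p.u w' w]
  · linarith [tri hG p.v w' w]

theorem dist_le_distVertex (p : GraphPoint G hG) (w w' : V) :
    (G.dist w w' : ℝ) ≤ p.distVertex w + p.distVertex w' := by
  have h1 := tri hG w p.u w'
  have h2 := tri hG w p.v w'
  have h3 := tri hG w p.u p.v
  have h4 := tri hG w p.v p.u
  have h5 := tri hG p.u p.v w'
  have h6 := tri hG p.v p.u w'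
  have e1 := dcomm (G := G) w p.u
  have e2 := dcomm (G := G) w p.v
  have e3 := dcomm (G := G) p.u p.v
  have n1 := p.tl_nonneg
  have n2 := p.tl_nonneg'
  have hl : (G.dist p.u p.v : ℝ) = p.t * p.len + (1 - p.t) * p.len := by
    unfold len; ring
  unfold distVertex
  rcases min_cases (p.t * p.len + (G.dist p.u w : ℝ)) ((1 - p.t) * p.len + G.dist p.v w) with
    h | h <;>
  rcases min_cases (p.t * p.len + (G.dist p.u w' : ℝ)) ((1 - p.t) * p.len + G.dist p.v w') with
    h' | h' <;> rw [h.1, h'.1] <;> linarith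

theorem pathDist_le (p q : GraphPoint G hG) (w : V) :
    p.pathDist q ≤ p.distVertex w + q.distVertex w := by
  have key : min (p.distVertex q.u + q.t * q.len) (p.distVertex q.v + (1 - q.t) * q.len) ≤
      p.distVertex w + q.distVertex w := by
    have h1 := p.distVertex_le q.u w
    have h2 := p.distVertex_le q.v w
    have e1 := dcomm (G := G) w q.u
    have e2 := dcomm (G := G) w q.v
    rcases min_cases (q.t * q.len + (G.dist q.u w : ℝ)) ((1 - q.t) * q.len + G.dist q.v w) with
      h | h
    · refine (min_le_left _ _).trans ?_
      unfold distVertex at *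
      linarith
    · refine (min_le_right _ _).trans ?_
      unfold distVertex at *
      linarith
  have pt := p.ht
  have qt := q.ht
  unfold pathDist
  split_ifs with h h'
  · refine le_trans ?_ key
    obtain ⟨hu, hv⟩ := h
    have hlen : q.len = p.len := by unfold len; rw [hu, hv]
    have hd : (G.dist q.u q.v : ℝ) = p.len := by unfold len; rw [hu, hv]
    have hd' : (G.dist q.v q.u : ℝ) = p.len := by rw [← hd, dcomm]
    have l0 := p.len_nonneg
    unfold distVertex
    simp only [hu, hv, hlen, hd, hd', SimpleGraph.dist_self, Nat.cast_zero]
    rcases abs_cases (p.t - q.t) with ha | ha <;> rw [ha.1] <;>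
      simp only [le_min_iff, ← min_add_add_right] <;>
      refine ⟨⟨?_, ?_⟩, ?_, ?_⟩ <;> nlinarith [pt.1, pt.2, qt.1, qt.2,
        mul_nonneg pt.1 l0, mul_nonneg qt.1 l0, mul_nonneg (sub_nonneg.2 pt.2) l0,
        mul_nonneg (sub_nonneg.2 qt.2) l0]
  · refine le_trans ?_ key
    obtain ⟨hu, hv⟩ := h'
    have hd : (G.dist q.v q.u : ℝ) = p.len := by unfold len; rw [hu, hv]
    have hd' : (G.dist q.u q.v : ℝ) = p.len := by rw [← hd, dcomm]
    have hlen : q.len = p.len := hd'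
    have l0 := p.len_nonneg
    unfold distVertex
    simp only [hu, hv, hlen, hd, hd', SimpleGraph.dist_self, Nat.cast_zero]
    rcases abs_cases (p.t - (1 - q.t)) with ha | ha <;> rw [ha.1] <;>
      simp only [le_min_iff, ← min_add_add_right] <;>
      refine ⟨⟨?_, ?_⟩, ?_, ?_⟩ <;> nlinarith [pt.1, pt.2, qt.1, qt.2,
        mul_nonneg pt.1 l0, mul_nonneg qt.1 l0, mul_nonneg (sub_nonneg.2 pt.2) l0,
        mul_nonneg (sub_nonneg.2 qt.2) l0]
  · exact key

theorem exists_pathDist_ge (p q : GraphPoint G hG) (h : ¬ p.SameEdge q) :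
    ∃ w, p.distVertex w + q.distVertex w ≤ p.pathDist q := by
  have h1 : ¬ (p.u = q.u ∧ p.v = q.v) := fun h' => h (Or.inl h')
  have h2 : ¬ (p.u = q.v ∧ p.v = q.u) := fun h' => h (Or.inr h')
  unfold pathDist
  rw [if_neg h1, if_neg h2]
  rcases min_cases (p.distVertex q.u + q.t * q.len) (p.distVertex q.v + (1 - q.t) * q.len) with
    h | h <;> rw [h.1]
  · refine ⟨q.u, ?_⟩
    have : q.distVertex q.u ≤ q.t * q.len :=
      (min_le_left _ _).trans (by simp)
    linarith
  · refine ⟨q.v, ?_⟩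
    have : q.distVertex q.v ≤ (1 - q.t) * q.len :=
      (min_le_right _ _).trans (by simp)
    linarith

theorem SameEdge.symm {p q : GraphPoint G hG} (h : p.SameEdge q) : q.SameEdge p := by
  unfold SameEdge at *; grind

theorem SameEdge.trans {p q r : GraphPoint G hG} (h : p.SameEdge q) (h' : q.SameEdge r) :
    p.SameEdge r := by
  unfold SameEdge at *; grind

theorem SameEdge.len_eq {p q : GraphPoint G hG} (h : p.SameEdge q) : p.len = q.len := by
  unfold len
  rcases h with ⟨h, h'⟩ | ⟨h, h'⟩ <;> rw [h, h']
  exact dcomm _ _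

theorem len_eq_zero {p : GraphPoint G hG} (h : p.u = p.v) : p.len = 0 := by
  unfold len; rw [h]; simp

theorem SameEdge.pathDist_eq_zero {p q : GraphPoint G hG} (h : p.SameEdge q) (hp : p.len = 0) :
    p.pathDist q = 0 := by
  unfold pathDist
  rw [hp]
  split_ifs with h1 h2
  · simp
  · simp
  · exact absurd h (by unfold SameEdge; tauto)

theorem pathDist_self (p : GraphPoint G hG) : p.pathDist p = 0 := by
  simp [pathDist]

theorem pathDist_comm_le (p q : GraphPoint G hG) : p.pathDist q ≤ q.pathDist p := by
  by_cases h : q.SameEdge p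
  · have hl := h.len_eq
    unfold pathDist
    rcases h with ⟨h, h'⟩ | ⟨h, h'⟩
    · rw [if_pos ⟨h.symm, h'.symm⟩, if_pos ⟨h, h'⟩, hl, abs_sub_comm]
    · by_cases e : p.u = q.u ∧ p.v = q.v
      · have : p.len = 0 := len_eq_zero (by rw [← h', ← e.2])
        rw [if_pos e, if_pos ⟨e.1.symm, e.2.symm⟩, hl, this]
        simp
      · have e' : ¬ (q.u = p.u ∧ q.v = p.v) := fun e' => e ⟨e'.1.symm, e'.2.symm⟩
        rw [if_neg e, if_neg e', if_pos ⟨h'.symm, h.symm⟩, if_pos ⟨h, h'⟩, hl]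
        apply le_of_eq
        congr 1
        rw [← abs_neg]
        rw [show -(p.t - (1 - q.t)) = -(p.t + q.t - 1) by ring,
          show q.t - (1 - p.t) = p.t + q.t - 1 by ring, abs_neg]
  · obtain ⟨w, hw⟩ := q.exists_pathDist_ge p h
    linarith [p.pathDist_le q w]

theorem pathDist_comm (p q : GraphPoint G hG) : p.pathDist q = q.pathDist p :=
  le_antisymm (pathDist_comm_le p q) (pathDist_comm_le q p)

theorem distVertex_le_pathDist (p q : GraphPoint G hG) (h : p.SameEdge q) (w : V) :
    p.distVertex w ≤ p.pathDist q + q.distVertex w := by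
  have l0 := p.len_nonneg
  have hl := h.len_eq
  unfold pathDist distVertex
  rw [← min_add_add_left]
  split_ifs with h1 h2
  · have := neg_abs_le (p.t - q.t)
    have := le_abs_self (p.t - q.t)
    rw [← hl, h1.1, h1.2]
    exact min_le_min (by nlinarith) (by nlinarith)
  · have := neg_abs_le (p.t - (1 - q.t))
    have := le_abs_self (p.t - (1 - q.t))
    rw [← hl, h2.1, h2.2, min_comm]
    exact min_le_min (by nlinarith) (by nlinarith)
  · exact absurd h (by unfold SameEdge; tauto)

theorem pathDist_triangle (p q r : GraphPoint G hG) :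
    p.pathDist r ≤ p.pathDist q + q.pathDist r := by
  by_cases h : p.SameEdge q
  · by_cases h' : q.SameEdge r
    · have l0 := p.len_nonneg
      have e1 := h.len_eq
      have e2 := h'.len_eq
      have a1 := abs_sub_le p.t q.t r.t
      have a2 := abs_sub_le p.t q.t (1 - r.t)
      have a3 := abs_sub_le p.t (1 - q.t) (1 - r.t)
      have a4 := abs_sub_le p.t (1 - q.t) r.t
      have b3 : |1 - q.t - (1 - r.t)| = |q.t - r.t| := by
        rw [← abs_neg]; congr 1; ring
      have b4 : |1 - q.t - r.t| = |q.t - (1 - r.t)| := by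
        rw [← abs_neg]; congr 1; ring
      rw [b3] at a3
      rw [b4] at a4
      by_cases hz : p.u = p.v
      · have z : p.len = 0 := len_eq_zero hz
        have z' : q.len = 0 := by rw [← e1, z]
        rw [(h.trans h').pathDist_eq_zero z, h.pathDist_eq_zero z, h'.pathDist_eq_zero z']
        simp
      · unfold pathDist
        rw [SameEdge] at h h'
        rw [← e1]
        split_ifs <;> first | (exfalso; grind) | nlinarith
    · obtain ⟨w, hw⟩ := q.exists_pathDist_ge r h'
      linarith [p.pathDist_le r w, p.distVertex_le_pathDist q h w]
  · obtain ⟨w, hw⟩ := p.exists_pathDist_ge q h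
    by_cases h' : q.SameEdge r
    · have := r.distVertex_le_pathDist q h'.symm w
      rw [pathDist_comm] at this
      linarith [p.pathDist_le r w]
    · obtain ⟨w', hw'⟩ := q.exists_pathDist_ge r h'
      linarith [p.pathDist_le r w, q.dist_le_distVertex w' w, r.distVertex_le w w']

instance : PseudoMetricSpace (GraphPoint G hG) where
  dist := pathDist
  dist_self := pathDist_self
  dist_comm := pathDist_comm
  dist_triangle := pathDist_triangle

end GraphPoint

/-- The geometric realization of a connected graph, with its path metric (each edge is isometric
to the unit interval). -/
abbrev GraphRealization {V : Type*} (G : SimpleGraph V) (hG : G.Connected) : Type _ :=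
  SeparationQuotient (GraphPoint G hG)

/-! ### Word metrics and hyperbolic groups -/

/-- The Cayley graph of a group with respect to a generating set is connected. -/
theorem mulCayley_connected {G : Type*} [Group G] {S : Set G} (hS : Subgroup.closure S = ⊤) :
    (SimpleGraph.mulCayley S).Connected := by
  have key : ∀ g : G, ∀ h : G, (SimpleGraph.mulCayley S).Reachable h (h * g) := by
    intro g
    have hg : g ∈ Subgroup.closure S := hS ▸ Subgroup.mem_top g
    induction hg using Subgroup.closure_induction with
    | mem x hx =>
      intro h
      by_cases e : h = h * x
      · rw [← e]
      · exact SimpleGraph.Adj.reachable ((SimpleGraph.mulCayley_adj S _ _).2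
          ⟨e, Or.inl (by simpa using hx)⟩)
    | one => intro h; rw [mul_one]
    | mul x y _ _ hx hy => intro h; rw [← mul_assoc]; exact (hx h).trans (hy _)
    | inv x _ hx => intro h; simpa using (hx (h * x⁻¹)).symm
  refine (SimpleGraph.connected_iff_exists_forall_reachable _).2 ⟨1, fun g => ?_⟩
  simpa using key g 1

/-- The word length `|g|_S` with respect to `S ∪ S⁻¹`, i.e. the distance from `1` to `g` in the
Cayley graph. -/
def wordLength {G : Type*} [Group G] (S : Set G) (g : G) : ℕ :=
  (SimpleGraph.mulCayley S).dist 1 g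

/-- A hyperbolic group: for some finite generating set, the Cayley graph with its path metric is
hyperbolic. -/
def IsHyperbolicGroup (G : Type*) [Group G] : Prop :=
  ∃ (S : Finset G) (hS : Subgroup.closure (S : Set G) = ⊤),
    IsRipsHyperbolic (GraphRealization (SimpleGraph.mulCayley (S : Set G)) (mulCayley_connected hS))

/-! ### Measure equivalence couplings -/

/-- `(Ω, XΓ, XΛ, μ)` is a measure equivalence coupling from `Γ` to `Λ`, for two actions on a
measurable space `Ω`. That `Ω` is standard Borel and that the actions are measurable, commute and
preserve `μ` is expressed by the type classes. -/
structure IsMECoupling (Γ Λ : Type*) [Group Γ] [Group Λ] {Ω : Type*} [MeasurableSpace Ω]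
    [StandardBorelSpace Ω] [MulAction Γ Ω] [MulAction Λ Ω] [SMulCommClass Γ Λ Ω]
    [MeasurableConstSMul Γ Ω] [MeasurableConstSMul Λ Ω] (μ : Measure Ω)
    [SMulInvariantMeasure Γ Ω μ] [SMulInvariantMeasure Λ Ω μ] (XΓ XΛ : Set Ω) : Prop where
  sigmaFinite : SigmaFinite μ
  ne_zero : μ ≠ 0
  free_left : ∀ g : Γ, g ≠ 1 → ∀ᵐ x ∂μ, g • x ≠ x
  free_right : ∀ l : Λ, l ≠ 1 → ∀ᵐ x ∂μ, l • x ≠ x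
  measurable_left : MeasurableSet XΓ
  measurable_right : MeasurableSet XΛ
  fundamental_left : IsFundamentalDomain Γ XΓ μ
  fundamental_right : IsFundamentalDomain Λ XΛ μ
  finite_left : μ XΓ < ∞
  finite_right : μ XΛ < ∞

/-- The cocycle `α : Γ × X → Λ` of a fundamental domain `X` of the action of `Λ`: for almost every
`x`, `α(g, x)` is the unique element of `Λ` with `α(g, x) • g • x ∈ X`. -/
def couplingCocycle {Γ : Type*} (Λ : Type*) [Group Γ] [Group Λ] {Ω : Type*} [MulAction Γ Ω]
    [MulAction Λ Ω] (X : Set Ω) (g : Γ) (x : Ω) : Λ :=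
  Classical.epsilon fun l : Λ => l • g • x ∈ X

/-- `φ`-integrability of the coupling from `Γ` to `Λ` with fundamental domain `X` for `Λ`. It does
not depend on the finite generating set `S` of `Λ`, because of the constants `c`. -/
def IsPhiIntegrable (Γ Λ : Type*) [Group Γ] [Group Λ] {Ω : Type*} [MeasurableSpace Ω]
    [MulAction Γ Ω] [MulAction Λ Ω] (φ : ℝ → ℝ) (μ : Measure Ω) (X : Set Ω) : Prop :=
  ∃ S : Finset Λ, Subgroup.closure (S : Set Λ) = ⊤ ∧ ∀ g : Γ, ∃ c : ℝ, 0 < c ∧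
    ∫⁻ x in X, ENNReal.ofReal (φ (wordLength (S : Set Λ) (couplingCocycle Λ X g x) / c)) ∂μ < ∞

/-- The coupling is cobounded: finitely many `Λ`-translates of `XΛ` cover `XΓ`. -/
def IsCobounded (Λ : Type*) [Group Λ] {Ω : Type*} [MulAction Λ Ω] (XΓ XΛ : Set Ω) : Prop :=
  ∃ F : Finset Λ, XΓ ⊆ (F : Set Λ) • XΛ

end

noncomputable section

/-! ### Geodesic segments -/

namespace IsGeodesicSegment

variable {X : Type*} [PseudoMetricSpace X] {a b : X} {A : Set X}

/-! A point x of the coupling gives a map b from Λ to Γ: b(l) is the inverse of an element of Γ that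
brings l⁻¹x back into XΓ. The moment of order 1 + 1/q bounds the jumps of b, and the exponential
moment, with coboundedness, bounds Λ-distances in terms of distances between the images. These
bounds fail for a fixed x over all of Λ, but only finitely many elements matter at a time: if T has
O(n) elements, a union bound finds an x that works along T (`exists_map_of_measure_tails_lt`).

Jumps along T are at most r as soon as n · r^(-(1+1/q)) is small. For the inverse, the cocycle into
Λ must be bounded by K on a ball of radius 4r in Γ, whose size is exponential in r; the exponential
moment allows K to be a multiple of r^(1/p). Elements with images at distance at most 4r are then
O(r^(1+1/p)) apart. Both conditions, with r^(1+1/p) = o(n), can be met for n^(q/(1+q)) ≪ r ≪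
n^(p/(1+p)), and such r exist because q < p (`exists_scale`).

Let u be a geodesic of Λ and v a path with the same ends, both of length at most n. Their images in
Γ have jumps at most r, and r exceeds a given multiple of log n, so geodesics of Γ are O(r)-close to
these images. For each i, the thin triangle on b(u 0), b(u i), b(u k) provides times i₁ ≤ i ≤ i₂ and
a point v j whose images lie within 4r of b(u i₁) (`exists_backtrack_close`). Hence u i₁, u i₂ and v
j are o(n)-close in Λ. As u is geodesic, i₂ - i₁ is o(n), so u i is o(n)-close to v
(`exists_wordLength_le_of_coarsePaths`).

Finally, a geodesic space in which geodesics are εn-close to all paths of length n with the same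
ends, at every large scale n and for one small ε, is hyperbolic
(`isRipsHyperbolic_of_geodesicsNearChains`). A triangle that is not D-slim forces one of perimeter
larger by at most 8D that is not 2D-slim; repeated doubling contradicts the linear slimness bound
given by the hypothesis. -/

theorem left_mem (h : IsGeodesicSegment a b A) : a ∈ A := by
  obtain ⟨c, h0, -, -, rfl⟩ := h
  exact ⟨0, ⟨le_rfl, dist_nonneg⟩, h0⟩

theorem right_mem (h : IsGeodesicSegment a b A) : b ∈ A := by
  obtain ⟨c, -, h1, -, rfl⟩ := h
  exact ⟨_, ⟨dist_nonneg, le_rfl⟩, h1⟩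

theorem symm (h : IsGeodesicSegment a b A) : IsGeodesicSegment b a A := by
  obtain ⟨c, h0, h1, hc, rfl⟩ := h
  rw [IsGeodesicSegment, dist_comm b a]
  refine ⟨fun t => c (dist a b - t), by simpa using h1, by simpa using h0, ?_, ?_⟩
  · intro s hs t ht
    rw [hc _ ⟨by linarith [hs.2], by linarith [hs.1]⟩ _ ⟨by linarith [ht.2], by linarith [ht.1]⟩,
      ← abs_neg]
    congr 1; ring
  · ext x
    constructor
    · rintro ⟨t, ht, rfl⟩
      exact ⟨dist a b - t, ⟨by linarith [ht.2], by linarith [ht.1]⟩, by simp⟩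
    · rintro ⟨t, ht, rfl⟩
      exact ⟨dist a b - t, ⟨by linarith [ht.2], by linarith [ht.1]⟩, rfl⟩

theorem dist_add_dist (h : IsGeodesicSegment a b A) {z : X} (hz : z ∈ A) :
    dist a z + dist z b = dist a b := by
  obtain ⟨c, h0, h1, hc, rfl⟩ := h
  obtain ⟨t, ht, rfl⟩ := hz
  have e0 := hc 0 ⟨le_rfl, dist_nonneg⟩ t ht
  have e1 := hc t ht (dist a b) ⟨dist_nonneg, le_rfl⟩
  rw [h0] at e0
  rw [h1] at e1
  rw [e0, e1, zero_sub, abs_neg, abs_of_nonneg ht.1, abs_sub_comm,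
    abs_of_nonneg (by linarith [ht.2])]
  ring

theorem dist_left_le (h : IsGeodesicSegment a b A) {z : X} (hz : z ∈ A) :
    dist a z ≤ dist a b := by
  linarith [h.dist_add_dist hz, dist_nonneg (x := z) (y := b)]

theorem exists_dist_eq (h : IsGeodesicSegment a b A) {t : ℝ} (ht : t ∈ Icc 0 (dist a b)) :
    ∃ z ∈ A, dist a z = t := by
  obtain ⟨c, h0, h1, hc, rfl⟩ := h
  refine ⟨c t, ⟨t, ht, rfl⟩, ?_⟩
  have := hc 0 ⟨le_rfl, dist_nonneg⟩ t ht
  rwa [h0, zero_sub, abs_neg, abs_of_nonneg ht.1] at this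

/-- A subinterval of the parameter interval gives a geodesic. -/
theorem image_Icc {c : ℝ → X} {L s t : ℝ}
    (hc : ∀ s ∈ Icc 0 L, ∀ t ∈ Icc 0 L, dist (c s) (c t) = |s - t|)
    (hs : 0 ≤ s) (hst : s ≤ t) (ht : t ≤ L) :
    IsGeodesicSegment (c s) (c t) (c '' Icc s t) := by
  have hd : dist (c s) (c t) = t - s := by
    rw [hc s ⟨hs, hst.trans ht⟩ t ⟨hs.trans hst, ht⟩, abs_sub_comm, abs_of_nonneg (by linarith)]
  refine ⟨fun u => c (s + u), by simp, by simp [hd], ?_, ?_⟩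
  · intro u hu v hv
    rw [hd] at hu hv
    rw [hc _ ⟨by linarith [hu.1], by linarith [hu.2]⟩ _ ⟨by linarith [hv.1], by linarith [hv.2]⟩]
    congr 1; ring
  · rw [hd]
    ext x
    constructor
    · rintro ⟨u, hu, rfl⟩
      exact ⟨u - s, ⟨by linarith [hu.1], by linarith [hu.2]⟩, by simp⟩
    · rintro ⟨u, hu, rfl⟩
      exact ⟨s + u, ⟨by linarith [hu.1], by linarith [hu.2]⟩, rfl⟩

theorem exists_subsegment (h : IsGeodesicSegment a b A) {x y : X} (hx : x ∈ A) (hy : y ∈ A) :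
    ∃ B ⊆ A, IsGeodesicSegment x y B := by
  obtain ⟨c, h0, h1, hc, rfl⟩ := h
  obtain ⟨s, hs, rfl⟩ := hx
  obtain ⟨t, ht, rfl⟩ := hy
  rcases le_total s t with hst | hst
  · exact ⟨_, image_mono (Icc_subset_Icc hs.1 ht.2), image_Icc hc hs.1 hst ht.2⟩
  · exact ⟨_, image_mono (Icc_subset_Icc ht.1 hs.2), (image_Icc hc ht.1 hst hs.2).symm⟩

/-- The part of a geodesic within distance `ρ` of one of its points. -/
theorem exists_subsegment_around (h : IsGeodesicSegment a b A) {m : X} (hm : m ∈ A) {ρ : ℝ}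
    (hρ : 0 ≤ ρ) :
    ∃ a' ∈ A, ∃ b' ∈ A, ∃ B, IsGeodesicSegment a' b' B ∧ m ∈ B ∧
      (a' = a ∨ dist a' m = ρ) ∧ (b' = b ∨ dist b' m = ρ) ∧ dist a' m ≤ ρ ∧ dist b' m ≤ ρ ∧
      dist a a' + dist a' b' + dist b' b = dist a b := by
  obtain ⟨c, h0, h1, hc, rfl⟩ := h
  obtain ⟨t, ht, rfl⟩ := hm
  set L := dist a b with hL
  have hL0 : 0 ≤ L := dist_nonneg
  have hs : max 0 (t - ρ) ∈ Icc 0 L := ⟨le_max_left _ _, max_le hL0 (by linarith [ht.2])⟩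
  have hu : min L (t + ρ) ∈ Icc 0 L := ⟨le_min hL0 (by linarith [ht.1]), min_le_left _ _⟩
  have hst : max 0 (t - ρ) ≤ t := max_le ht.1 (by linarith)
  have htu : t ≤ min L (t + ρ) := le_min ht.2 (by linarith)
  have h00 : (0 : ℝ) ∈ Icc 0 L := ⟨le_rfl, hL0⟩
  have hLL : L ∈ Icc 0 L := ⟨hL0, le_rfl⟩
  refine ⟨c (max 0 (t - ρ)), ⟨_, hs, rfl⟩, c (min L (t + ρ)), ⟨_, hu, rfl⟩, _,
    image_Icc hc hs.1 (hst.trans htu) hu.2, ⟨t, ⟨hst, htu⟩, rfl⟩, ?_, ?_, ?_, ?_, ?_⟩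
  · rcases max_cases 0 (t - ρ) with e | e
    · left; rw [e.1, h0]
    · right; rw [hc _ hs _ ht, e.1, show t - ρ - t = -ρ by ring, abs_neg, abs_of_nonneg hρ]
  · rcases min_cases L (t + ρ) with e | e
    · left; rw [e.1, h1]
    · right; rw [hc _ hu _ ht, e.1, show t + ρ - t = ρ by ring, abs_of_nonneg hρ]
  · rw [hc _ hs _ ht, abs_sub_comm, abs_of_nonneg (by linarith)]
    linarith [le_max_right 0 (t - ρ)]
  · rw [hc _ hu _ ht, abs_of_nonneg (by linarith)]
    linarith [min_le_right L (t + ρ)]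
  · have e1 := hc 0 h00 _ hs
    have e2 := hc _ hs _ hu
    have e3 := hc _ hu _ hLL
    rw [h0, abs_sub_comm, abs_of_nonneg (by linarith [hs.1])] at e1
    rw [abs_sub_comm, abs_of_nonneg (by linarith)] at e2
    rw [h1, abs_sub_comm, abs_of_nonneg (by linarith [hu.2])] at e3
    rw [e1, e2, e3]; ring

theorem singleton (a : X) : IsGeodesicSegment a a {a} :=
  ⟨fun _ => a, rfl, rfl, fun s hs t ht => by
    simp only [dist_self, Icc_self, mem_singleton_iff] at hs ht; simp [hs, ht], by simp⟩

/-- Concatenation of geodesics. -/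
theorem concat {c : X} {B : Set X} (h : IsGeodesicSegment a b A) (h' : IsGeodesicSegment b c B)
    (hd : dist a b + dist b c = dist a c) : ∃ C, IsGeodesicSegment a c C := by
  obtain ⟨f, f0, f1, hf, -⟩ := h
  obtain ⟨g, g0, g1, hg, -⟩ := h'
  have key : ∀ s ∈ Icc 0 (dist a b), ∀ t ∈ Icc 0 (dist b c),
      dist (f s) (g t) = dist a b - s + t := by
    intro s hs t ht
    have e1 := hf 0 ⟨le_rfl, dist_nonneg⟩ s hs
    have e2 := hf s hs _ ⟨dist_nonneg, le_rfl⟩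
    have e3 := hg 0 ⟨le_rfl, dist_nonneg⟩ t ht
    have e4 := hg t ht _ ⟨dist_nonneg, le_rfl⟩
    rw [f0, zero_sub, abs_neg, abs_of_nonneg hs.1] at e1
    rw [f1, abs_sub_comm, abs_of_nonneg (by linarith [hs.2])] at e2
    rw [g0, zero_sub, abs_neg, abs_of_nonneg ht.1] at e3
    rw [g1, abs_sub_comm, abs_of_nonneg (by linarith [ht.2])] at e4
    have t1 := dist_triangle (f s) b (g t)
    have t2 := dist_triangle4 a (f s) (g t) c
    linarith
  refine ⟨_, fun t => if t ≤ dist a b then f t else g (t - dist a b), by simp [f0], ?_, ?_, rfl⟩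
  · simp only [← hd]
    split_ifs with h
    · have h0 : dist b c = 0 := by linarith [dist_nonneg (x := b) (y := c)]
      rw [h0] at g1
      rw [h0, add_zero, f1, ← g0, g1]
    · rw [add_sub_cancel_left, g1]
  · intro s hs t ht
    rw [← hd] at hs ht
    simp only
    split_ifs with h1 h2 h2
    · exact hf s ⟨hs.1, h1⟩ t ⟨ht.1, h2⟩
    · rw [key s ⟨hs.1, h1⟩ _ ⟨by linarith, by linarith [ht.2]⟩, abs_sub_comm,
        abs_of_nonneg (by linarith)]
      ring
    · rw [dist_comm, key t ⟨ht.1, h2⟩ _ ⟨by linarith, by linarith [hs.2]⟩,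
        abs_of_nonneg (by linarith)]
      ring
    · rw [hg _ ⟨by linarith, by linarith [hs.2]⟩ _ ⟨by linarith, by linarith [ht.2]⟩]
      congr 1; ring

end IsGeodesicSegment

/-! ### Coarse paths in hyperbolic spaces -/

section Hyperbolic

variable {Y : Type*} [PseudoMetricSpace Y] {δ r : ℝ}

/-- In a hyperbolic space a geodesic stays logarithmically close to any coarse path with the same
end points. -/
theorem exists_dist_le_of_coarsePath (hgeo : IsGeodesicSpace Y) (hδ : HasSlimTriangles Y δ)
    (hr : 0 ≤ r) (m : ℕ) : ∀ (k : ℕ) (y : ℕ → Y) (A : Set Y), k ≤ 2 ^ m →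
    (∀ i < k, dist (y i) (y (i + 1)) ≤ r) → IsGeodesicSegment (y 0) (y k) A →
    ∀ z ∈ A, ∃ j ≤ k, dist z (y j) ≤ δ * m + r := by
  induction m with
  | zero =>
    intro k y A hk hy hA z hz
    refine ⟨0, Nat.zero_le _, ?_⟩
    have h1 := hA.dist_left_le hz
    have h2 : dist (y 0) (y k) ≤ r := by
      have : k = 0 ∨ k = 1 := by simp at hk; omega
      rcases this with rfl | rfl
      · simpa using hr
      · exact hy 0 (by norm_num)
    rw [dist_comm]
    simpa using h1.trans h2
  | succ m ih =>
    intro k y A hk hy hA z hz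
    -- Halving the path costs one triangle, hence one δ; after m halvings a single step of length at
    -- most r is left.
    obtain ⟨h, hhk, hh, hkh⟩ : ∃ h ≤ k, h ≤ 2 ^ m ∧ k - h ≤ 2 ^ m :=
      ⟨min k (2 ^ m), min_le_left _ _, min_le_right _ _, by rw [pow_succ] at hk; omega⟩
    obtain ⟨P, hP⟩ := hgeo (y 0) (y h)
    obtain ⟨Q, hQ⟩ := hgeo (y h) (y k)
    obtain ⟨w, hw, hzw⟩ := hδ _ _ _ _ _ _ hA hP hQ.symm z hz
    have tri := fun j => dist_triangle z w (y j)
    rcases hw with hw | hw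
    · obtain ⟨j, hj, hwj⟩ := ih h y P hh (fun i hi => hy i (by omega)) hP w hw
      exact ⟨j, by omega, by push_cast; linarith [tri j]⟩
    · obtain ⟨j, hj, hwj⟩ := ih (k - h) (fun i => y (h + i)) Q hkh
        (fun i hi => hy (h + i) (by omega)) (by simpa [Nat.add_sub_cancel' hhk] using hQ) w hw
      exact ⟨h + j, by omega, by push_cast; linarith [tri (h + j)]⟩

/-- A point on one side of a geodesic triangle which is close to both other sides. -/
theorem exists_close_to_both_sides (hδ0 : 0 ≤ δ) (hδ : HasSlimTriangles Y δ) {a b c : Y}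
    {A P Q : Set Y} (hA : IsGeodesicSegment a b A) (hP : IsGeodesicSegment a c P)
    (hQ : IsGeodesicSegment b c Q) :
    ∃ z ∈ A, (∃ p ∈ P, dist z p ≤ δ + 1) ∧ ∃ q ∈ Q, dist z q ≤ δ + 1 := by
  have slim := hδ _ _ _ _ _ _ hA hP hQ
  obtain ⟨f, f0, f1, hf, hAf⟩ := hA
  subst hAf
  set S := {t ∈ Icc 0 (dist a b) | ∃ p ∈ P, dist (f t) p ≤ δ} with hS
  have h0 : (0 : ℝ) ∈ S :=
    ⟨⟨le_rfl, dist_nonneg⟩, a, hP.left_mem, by simpa [f0] using hδ0⟩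
  have hbdd : BddAbove S := ⟨dist a b, fun t ht => ht.1.2⟩
  -- A parameter within 1 of the supremum replaces a limit argument: one unit further the point is
  -- no longer δ-close to P, so it is δ-close to Q.
  obtain ⟨t, ht, htlt⟩ := exists_lt_of_lt_csSup ⟨0, h0⟩
    (show sSup S - 1 < sSup S by linarith)
  obtain ⟨p, hp, htp⟩ := ht.2
  refine ⟨f t, ⟨t, ht.1, rfl⟩, ⟨p, hp, by linarith⟩, ?_⟩
  by_cases hL : t + 1 ≤ dist a b
  · have hmem : t + 1 ∈ Icc 0 (dist a b) := ⟨by linarith [ht.1.1], hL⟩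
    have hnot : t + 1 ∉ S := fun h => by linarith [le_csSup hbdd h]
    obtain ⟨w, hw, hdw⟩ := slim (f (t + 1)) ⟨_, hmem, rfl⟩
    rcases hw with hw | hw
    · exact absurd ⟨hmem, w, hw, hdw⟩ hnot
    · refine ⟨w, hw, ?_⟩
      have := hf t ht.1 _ hmem
      rw [show t - (t + 1) = -1 by ring, abs_neg, abs_one] at this
      linarith [dist_triangle (f t) (f (t + 1)) w]
  · refine ⟨b, hQ.left_mem, ?_⟩
    have := hf t ht.1 (dist a b) ⟨dist_nonneg, le_rfl⟩
    rw [f1, abs_sub_comm, abs_of_nonneg (by linarith [ht.1.2])] at this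
    linarith

/-- Two coarse paths with the same end points in a hyperbolic space: each point of the first one
lies between two instants at which it is at nearly the same place, and there it is close to the
second one. -/
theorem exists_backtrack_close (hgeo : IsGeodesicSpace Y) (hδ0 : 0 ≤ δ)
    (hδ : HasSlimTriangles Y δ) {m k l : ℕ} (hr : δ * (m + 1) + 1 ≤ r) (hk : k ≤ 2 ^ m)
    (hl : l ≤ 2 ^ m) {u v : ℕ → Y} (hu : ∀ i < k, dist (u i) (u (i + 1)) ≤ r)
    (hv : ∀ i < l, dist (v i) (v (i + 1)) ≤ r) (h0 : u 0 = v 0) (h1 : u k = v l) {i : ℕ}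
    (hi : i ≤ k) :
    ∃ i₁ ≤ i, ∃ i₂ ≤ k, i ≤ i₂ ∧ ∃ j ≤ l, dist (u i₁) (u i₂) ≤ 4 * r ∧
      dist (u i₁) (v j) ≤ 4 * r := by
  have hr0 : 0 ≤ r := by have : (0 : ℝ) ≤ δ * (m + 1) := by positivity
                         linarith
  obtain ⟨A, hA⟩ := hgeo (u 0) (u k)
  obtain ⟨P, hP⟩ := hgeo (u 0) (u i)
  obtain ⟨Q, hQ⟩ := hgeo (u i) (u k)
  -- The point z is an approximate centre of the triangle on `u 0`, `u i`, `u k`. Its side through P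
  -- yields a time before i, its side through Q a time after i. Each of the two lies within (δ + 1)
  -- + (δm + r) ≤ 2r of z, which is where 4r comes from.
  obtain ⟨z, hz, ⟨p, hp, hzp⟩, s, hs, hzs⟩ := exists_close_to_both_sides hδ0 hδ hA hP hQ.symm
  obtain ⟨i₁, hi₁, hpi⟩ := exists_dist_le_of_coarsePath hgeo hδ hr0 m i u P (by omega)
    (fun i' hi' => hu i' (by omega)) hP p hp
  obtain ⟨i₂, hi₂, hsi⟩ := exists_dist_le_of_coarsePath hgeo hδ hr0 m (k - i) (fun t => u (i + t)) Q
    (by omega) (fun i' hi' => hu (i + i') (by omega))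
    (by simpa [Nat.add_sub_cancel' hi] using hQ) s hs
  obtain ⟨j, hj, hzj⟩ := exists_dist_le_of_coarsePath hgeo hδ hr0 m l v A hl hv
    (by rwa [← h0, ← h1]) z hz
  refine ⟨i₁, hi₁, i + i₂, by omega, by omega, j, hj, ?_, ?_⟩
  · have t1 := dist_triangle z p (u i₁)
    have t2 := dist_triangle z s (u (i + i₂))
    have t3 := dist_triangle_left (u i₁) (u (i + i₂)) z
    linarith
  · have t1 := dist_triangle z p (u i₁)
    have t3 := dist_triangle_left (u i₁) (v j) z
    linarith

end Hyperbolic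

/-! ### Hyperbolicity from sublinear closeness -/

section Sublinear

variable {X : Type*} [PseudoMetricSpace X]

/-- `u` and `v` are joined in `E` by `k` steps of length at most one. -/
def ChainIn (E : Set X) (k : ℕ) (u v : X) : Prop :=
  ∃ x : ℕ → X, x 0 = u ∧ x k = v ∧ (∀ i < k, dist (x i) (x (i + 1)) ≤ 1) ∧ ∀ i ≤ k, x i ∈ E

/-- At scale `n ≥ n₀`, geodesics are `ε * n`-close to chains with the same end points. -/
def GeodesicsNearChains (X : Type*) [PseudoMetricSpace X] (ε n₀ : ℝ) : Prop :=
  ∀ n ≥ n₀, ∀ (a b : X) (A E : Set X), IsGeodesicSegment a b A → dist a b ≤ n →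
    ∀ k : ℕ, (k : ℝ) ≤ n → ChainIn E k a b → ∀ m ∈ A, ∃ e ∈ E, dist m e ≤ ε * n

/-- Geodesic triangles of perimeter at most `N` are `D`-slim. -/
def SlimUpTo (X : Type*) [PseudoMetricSpace X] (N D : ℝ) : Prop :=
  ∀ (a₁ a₂ a₃ : X) (A₁₂ A₁₃ A₂₃ : Set X),
    IsGeodesicSegment a₁ a₂ A₁₂ → IsGeodesicSegment a₁ a₃ A₁₃ → IsGeodesicSegment a₂ a₃ A₂₃ →
    dist a₁ a₂ + dist a₁ a₃ + dist a₂ a₃ ≤ N → ∀ x ∈ A₁₂, ∃ y ∈ A₁₃ ∪ A₂₃, dist x y ≤ D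

theorem ChainIn.refl {E : Set X} {u : X} (hu : u ∈ E) : ChainIn E 0 u u :=
  ⟨fun _ => u, rfl, rfl, by simp, fun _ _ => hu⟩

theorem ChainIn.trans {E : Set X} {k l : ℕ} {u v w : X} (h : ChainIn E k u v)
    (h' : ChainIn E l v w) : ChainIn E (k + l) u w := by
  obtain ⟨x, x0, x1, hx, hxE⟩ := h
  obtain ⟨y, y0, y1, hy, hyE⟩ := h'
  refine ⟨fun i => if i ≤ k then x i else y (i - k), by simp [x0], ?_, ?_, ?_⟩
  · simp only
    split_ifs with h
    · have : l = 0 := by omega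
      subst this
      rw [add_zero, x1, ← y0, y1]
    · rw [Nat.add_sub_cancel_left, y1]
  · intro i hi
    simp only
    rcases lt_trichotomy i k with h | h | h
    · rw [if_pos h.le, if_pos (by omega)]; exact hx i h
    · subst h
      rw [if_pos le_rfl, if_neg (by omega), x1, ← y0, Nat.add_sub_cancel_left]
      exact hy 0 (by omega)
    · rw [if_neg (by omega), if_neg (by omega), show i + 1 - k = i - k + 1 by omega]
      exact hy _ (by omega)
  · intro i hi
    simp only
    split_ifs with h
    · exact hxE i h
    · exact hyE _ (by omega)

theorem ChainIn.symm {E : Set X} {k : ℕ} {u v : X} (h : ChainIn E k u v) : ChainIn E k v u := by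
  obtain ⟨x, x0, x1, hx, hxE⟩ := h
  refine ⟨fun i => x (k - i), by simpa using x1, by simpa using x0, ?_,
    fun i hi => hxE _ (Nat.sub_le _ _)⟩
  intro i hi
  have := hx (k - (i + 1)) (by omega)
  rwa [dist_comm, show k - (i + 1) + 1 = k - i by omega] at this

theorem IsGeodesicSegment.chainIn {a b : X} {A E : Set X} (h : IsGeodesicSegment a b A)
    (hE : A ⊆ E) : ∃ k : ℕ, (k : ℝ) ≤ dist a b + 1 ∧ ChainIn E k a b := by
  obtain ⟨c, h0, h1, hc, rfl⟩ := h
  have hmem : ∀ i : ℕ, min (i : ℝ) (dist a b) ∈ Icc 0 (dist a b) := fun i =>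
    ⟨le_min (Nat.cast_nonneg _) dist_nonneg, min_le_right _ _⟩
  refine ⟨⌈dist a b⌉₊, (Nat.ceil_lt_add_one dist_nonneg).le,
    fun i => c (min i (dist a b)), by simp [h0], ?_, ?_, fun i _ => hE ⟨_, hmem i, rfl⟩⟩
  · simp only
    rw [min_eq_right (Nat.le_ceil _), h1]
  · intro i _
    simp only
    rw [hc _ (hmem i) _ (hmem (i + 1)), abs_le]
    push_cast
    constructor
    · rcases min_cases (i : ℝ) (dist a b) with h | h <;>
      rcases min_cases ((i : ℝ) + 1) (dist a b) with h' | h' <;> rw [h.1, h'.1] <;> linarith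
    · rcases min_cases (i : ℝ) (dist a b) with h | h <;>
      rcases min_cases ((i : ℝ) + 1) (dist a b) with h' | h' <;> rw [h.1, h'.1] <;> linarith

/-- Two geodesics issuing from nearby points towards a common point can be joined by a short chain
which leaves them only far away. -/
theorem exists_chainIn_of_slimUpTo (hgeo : IsGeodesicSpace X) {M D : ℝ} (hD : 1 ≤ D)
    (hslim : SlimUpTo X M (2 * D)) {y z c : X} {U W E : Set X} (hU : IsGeodesicSegment y c U)
    (hW : IsGeodesicSegment z c W) (hUE : U ⊆ E) (hWE : W ⊆ E) (hyz : dist y z ≤ 44 * D)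
    (hM : dist y c + dist y z + dist c z ≤ M) (hE : ∀ e, 98 * D ≤ dist y e → e ∈ E) :
    ∃ k : ℕ, (k : ℝ) ≤ 251 * D ∧ ChainIn E k y z := by
  by_cases hc : dist y c ≤ 100 * D
  · obtain ⟨k, hk, h⟩ := hU.chainIn hUE
    obtain ⟨l, hl, h'⟩ := hW.chainIn hWE
    refine ⟨k + l, ?_, h.trans h'.symm⟩
    have := dist_triangle_left z c y
    push_cast; linarith
  push Not at hc
  obtain ⟨y', hy', hyy'⟩ := hU.exists_dist_eq (t := 100 * D) ⟨by linarith, hc.le⟩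
  obtain ⟨V, hV⟩ := hgeo y z
  obtain ⟨z', hz', hyz'⟩ := hslim _ _ _ _ _ _ hU hV hW.symm hM y' hy'
  -- The point y' is 100D away from y, too far to be 2D-close to the side [y, z] of length at most
  -- 44D.
  have hz'W : z' ∈ W := by
    rcases hz' with h | h
    · have h1 := hV.dist_left_le h
      have h2 := dist_triangle_right y y' z'
      linarith
    · exact h
  obtain ⟨U', hU'U, hU'⟩ := hU.exists_subsegment hU.left_mem hy'
  obtain ⟨W', hW'W, hW'⟩ := hW.exists_subsegment hz'W hW.left_mem
  obtain ⟨V', hV'⟩ := hgeo y' z'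
  obtain ⟨k₁, hk₁, h₁⟩ := hU'.chainIn (hU'U.trans hUE)
  obtain ⟨k₂, hk₂, h₂⟩ := hV'.chainIn (E := E) fun e he => hE e (by
    have h1 := hV'.dist_left_le he
    have h2 := dist_triangle_right y y' e
    linarith [dist_comm y' e])
  obtain ⟨k₃, hk₃, h₃⟩ := hW'.chainIn (hW'W.trans hWE)
  refine ⟨k₁ + k₂ + k₃, ?_, (h₁.trans h₂).trans h₃⟩
  have e1 := dist_triangle4_left z' z y' y
  have e2 := dist_comm y y'
  have e3 := dist_triangle z' y' z
  have e4 := dist_triangle y' y z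
  have e5 := dist_comm z' y'
  push_cast
  linarith

/-- If m is D-far from the other two sides, 2D-slimness of slightly larger triangles gives a detour
around m of length O(D) that avoids the D-ball of m except possibly along those sides. The nearness
hypothesis at scale 300D puts m within ε · 300D < D of the detour, a contradiction. The added 8D
bounds the excess of the perimeter of the triangle y, z, c, whose vertices y and z are 2D-close to
the side A. -/
theorem SlimUpTo.of_double (hgeo : IsGeodesicSpace X) {ε n₀ N D : ℝ} (hε : ε * 300 < 1)
    (hnear : GeodesicsNearChains X ε n₀) (hD : 1 ≤ D) (hn₀ : n₀ ≤ D)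
    (hslim : SlimUpTo X (N + 8 * D) (2 * D)) : SlimUpTo X N D := by
  intro a b c A P Q hA hP hQ hN m hm
  by_contra! hfar
  set E : Set X := {e | e ∈ P ∪ Q ∨ D < dist m e} with hE
  have hPE : P ⊆ E := fun e he => Or.inl (Or.inl he)
  have hQE : Q ⊆ E := fun e he => Or.inl (Or.inr he)
  have hslim' := hslim _ _ _ _ _ _ hA hP hQ (by linarith)
  -- With radius 20D, the 2D-short hops from a' and b' to the other sides stay more than D from m,
  -- unless a' or b' is already a vertex of the triangle, where no hop is needed.
  obtain ⟨a', ha', b', hb', B, hB, hmB, haa, hbb, ham, hbm, hsum⟩ :=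
    hA.exists_subsegment_around hm (ρ := 20 * D) (by linarith)
  have approach : ∀ a₀ ∈ P ∪ Q, ∀ a' ∈ A, (a' = a₀ ∨ dist a' m = 20 * D) →
      ∃ y ∈ P ∪ Q, dist a' y ≤ 2 * D ∧ ∃ k : ℕ, (k : ℝ) ≤ 2 * D + 1 ∧ ChainIn E k a' y := by
    intro a₀ ha₀ a' ha' h
    rcases h with rfl | h
    · exact ⟨a', ha₀, by simp; linarith, 0, by push_cast; linarith, ChainIn.refl (Or.inl ha₀)⟩
    · obtain ⟨y, hy, hd⟩ := hslim' a' ha'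
      obtain ⟨V, hV⟩ := hgeo a' y
      obtain ⟨k, hk, hch⟩ := hV.chainIn (E := E) fun e he => Or.inr (by
        have h1 := hV.dist_left_le he
        have h2 := dist_triangle_right a' m e
        linarith)
      exact ⟨y, hy, hd, k, by linarith, hch⟩
  obtain ⟨y, hy, hay, k₁, hk₁, hch₁⟩ := approach a (Or.inl hP.left_mem) a' ha' haa
  obtain ⟨z, hz, hbz, k₃, hk₃, hch₃⟩ := approach b (Or.inr hQ.left_mem) b' hb' hbb
  have hab : dist a' b' ≤ 40 * D := by linarith [dist_triangle_right a' b' m]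
  have hyz : dist y z ≤ dist a' b' + 4 * D := by
    have h1 := dist_triangle4 y a' b' z
    linarith [dist_comm y a']
  have hyfar : ∀ e, 98 * D ≤ dist y e → e ∈ E := fun e he => Or.inr (by
    have h1 := dist_triangle y m e
    have h2 := dist_triangle_left y m a'
    linarith)
  have hcz := dist_comm c z
  have hcy := dist_comm c y
  have hca := dist_comm c a
  have hcb := dist_comm c b
  have middle : ∃ k : ℕ, (k : ℝ) ≤ 251 * D ∧ ChainIn E k y z := by
    rcases hy with hy | hy <;> rcases hz with hz | hz
    · obtain ⟨V, hVP, hV⟩ := hP.exists_subsegment hy hz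
      obtain ⟨k, hk, h⟩ := hV.chainIn (hVP.trans hPE)
      exact ⟨k, by linarith, h⟩
    · obtain ⟨U, hUP, hU⟩ := hP.exists_subsegment hy hP.right_mem
      obtain ⟨W, hWQ, hW⟩ := hQ.exists_subsegment hz hQ.right_mem
      refine exists_chainIn_of_slimUpTo hgeo hD hslim hU hW (hUP.trans hPE) (hWQ.trans hQE)
        (by linarith) ?_ hyfar
      have h1 := hP.dist_add_dist hy
      have h2 := hQ.dist_add_dist hz
      have h3 := dist_triangle_right a a' y
      have h4 := dist_triangle_right b b' z
      linarith [dist_comm b b', dist_comm y a', dist_comm z b',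
        dist_nonneg (x := a) (y := a'), dist_nonneg (x := b) (y := b')]
    · obtain ⟨U, hUQ, hU⟩ := hQ.exists_subsegment hy hQ.right_mem
      obtain ⟨W, hWP, hW⟩ := hP.exists_subsegment hz hP.right_mem
      refine exists_chainIn_of_slimUpTo hgeo hD hslim hU hW (hUQ.trans hQE) (hWP.trans hPE)
        (by linarith) ?_ hyfar
      have h1 := hQ.dist_add_dist hy
      have h2 := hP.dist_add_dist hz
      have h3 := dist_triangle_right b a' y
      have h4 := dist_triangle_right a b' z
      have h5 := hA.dist_add_dist ha'
      have h6 := hA.dist_add_dist hb'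
      linarith [dist_comm b a', dist_nonneg (x := a) (y := b)]
    · obtain ⟨V, hVP, hV⟩ := hQ.exists_subsegment hy hz
      obtain ⟨k, hk, h⟩ := hV.chainIn (hVP.trans hQE)
      exact ⟨k, by linarith, h⟩
  obtain ⟨k₂, hk₂, hch₂⟩ := middle
  -- The detour has at most 251D + 2(2D + 1) ≤ 257D steps.
  obtain ⟨e, he, hme⟩ := hnear (300 * D) (by linarith) a' b' B E hB (by linarith)
    (k₁ + k₂ + k₃) (by push_cast; linarith) ((hch₁.trans hch₂).trans hch₃.symm) m hmB
  have hlt : ε * (300 * D) < D := by nlinarith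
  rcases he with he | he
  · linarith [hfar e he]
  · linarith

/-- A geodesic space in which geodesics are close, on all large scales and up to a small multiple
of the scale, to chains with the same end points, is hyperbolic. -/
theorem isRipsHyperbolic_of_geodesicsNearChains (hgeo : IsGeodesicSpace X) {ε n₀ : ℝ}
    (hε : ε * 300 < 1) (hnear : GeodesicsNearChains X ε n₀) :
    IsRipsHyperbolic X := by
  set D := max 1 n₀ with hDdef
  have hD : 1 ≤ D := le_max_left _ _
  have hn₀ : n₀ ≤ D := le_max_right _ _
  have coarse : ∀ M ≥ D, SlimUpTo X M (ε * (3 * M)) := by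
    intro M hM a b c A P Q hA hP hQ hN m hm
    obtain ⟨k, hk, h⟩ := hP.chainIn (E := P ∪ Q) subset_union_left
    obtain ⟨l, hl, h'⟩ := hQ.chainIn (E := P ∪ Q) subset_union_right
    refine hnear (3 * M) (by linarith) a b A (P ∪ Q) hA ?_ (k + l) ?_ (h.trans h'.symm) m hm
    · linarith [dist_nonneg (x := a) (y := c), dist_nonneg (x := b) (y := c)]
    · push_cast
      linarith [dist_nonneg (x := a) (y := b)]
  have main : ∀ N, SlimUpTo X N D := by
    intro N
    by_contra hnot
    -- Contrapositive of `SlimUpTo.of_double`, iterated: D doubles and the perimeter bound grows by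
    -- the geometric sum of the 8 · 2^i · D.
    have iter : ∀ k : ℕ, ¬ SlimUpTo X (N + 8 * ((2 ^ k - 1) * D)) (2 ^ k * D) := by
      intro k
      induction k with
      | zero => simpa using hnot
      | succ k ih =>
        intro h
        refine ih (SlimUpTo.of_double hgeo hε hnear ?_ ?_ ?_)
        · nlinarith [one_le_pow₀ (M₀ := ℝ) one_le_two (n := k)]
        · nlinarith [one_le_pow₀ (M₀ := ℝ) one_le_two (n := k)]
        · convert h using 1 <;> ring
    obtain ⟨k, hk⟩ := pow_unbounded_of_one_lt |N| (one_lt_two (α := ℝ))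
    have h1 := one_le_pow₀ (M₀ := ℝ) one_le_two (n := k)
    have hNle := le_abs_self N
    have h2 : (0 : ℝ) ≤ (2 ^ k - 1) * (D - 1) := mul_nonneg (by linarith) (by linarith)
    have hbig : N + 8 * ((2 ^ k - 1) * D) ≤ 9 * (2 ^ k * D) := by nlinarith
    -- Once 2^k > |N| the perimeter bound is at most 9 · 2^k D, and `coarse` gives slimness 27ε ·
    -- 2^k D, below 2^k D.
    refine iter k fun a b c A P Q hA hP hQ hN m hm => ?_
    obtain ⟨y, hy, hmy⟩ := coarse (9 * (2 ^ k * D)) (by nlinarith) a b c A P Q hA hP hQ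
      (hN.trans hbig) m hm
    exact ⟨y, hy, hmy.trans (by nlinarith)⟩
  exact ⟨hgeo, D, by linarith, fun a b c A P Q hA hP hQ => main _ a b c A P Q hA hP hQ le_rfl⟩

end Sublinear

/-! ### The geometric realization of a graph is a geodesic space -/

namespace GraphPoint

variable {V : Type*} {G : SimpleGraph V} {hG : G.Connected}

theorem dist_eq_pathDist (p q : GraphPoint G hG) : dist p q = p.pathDist q := rfl

theorem len_le_one (p : GraphPoint G hG) : p.len ≤ 1 := by
  unfold len
  rcases p.edge with h | h
  · simp [h]
  · simp [SimpleGraph.dist_eq_one_iff_adj.2 h]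

theorem len_eq_one {p : GraphPoint G hG} (h : p.u ≠ p.v) : p.len = 1 := by
  unfold len
  simp [SimpleGraph.dist_eq_one_iff_adj.2 (p.edge.resolve_left h)]

/-- A vertex, as a point of the realization. -/
def vertex (hG : G.Connected) (w : V) : GraphPoint G hG := ⟨w, w, Or.inl rfl, 0, by simp⟩

theorem dist_vertex (p : GraphPoint G hG) (w : V) : dist p (vertex hG w) = p.distVertex w := by
  have hlen : (vertex hG w).len = 0 := len_eq_zero rfl
  by_cases h : p.SameEdge (vertex hG w)
  · have hl := h.len_eq.trans hlen
    have hu : p.u = w := by rcases h with h | h <;> exact h.1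
    rw [dist_eq_pathDist, h.pathDist_eq_zero hl]
    simp only [distVertex, hl, hu, mul_zero, SimpleGraph.dist_self, Nat.cast_zero, add_zero,
      zero_add]
    rw [min_eq_left (Nat.cast_nonneg _)]
  · rw [dist_eq_pathDist, pathDist, if_neg fun h' => h (Or.inl h'), if_neg fun h' => h (Or.inr h'),
      hlen]
    simp [vertex]

theorem dist_vertex_vertex (v w : V) : dist (vertex hG v) (vertex hG w) = G.dist v w := by
  rw [dist_vertex, distVertex, len_eq_zero rfl]
  simp [vertex]

theorem dist_vertex_u_le (p : GraphPoint G hG) : dist p (vertex hG p.u) ≤ p.t * p.len := by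
  rw [dist_vertex]
  exact (min_le_left _ _).trans (by simp)

theorem dist_vertex_v_le (p : GraphPoint G hG) : dist p (vertex hG p.v) ≤ (1 - p.t) * p.len := by
  rw [dist_vertex]
  exact (min_le_right _ _).trans (by simp)

/-- The point with parameter `s` on the edge of `p`. -/
def onEdge (p : GraphPoint G hG) (s : ℝ) : GraphPoint G hG :=
  ⟨p.u, p.v, p.edge, projIcc 0 1 zero_le_one s, (projIcc 0 1 zero_le_one s).2⟩

theorem onEdge_t (p : GraphPoint G hG) {s : ℝ} (hs : s ∈ Icc (0 : ℝ) 1) : (p.onEdge s).t = s := by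
  simp [onEdge, projIcc_of_mem zero_le_one hs]

theorem dist_onEdge (p : GraphPoint G hG) {s t : ℝ} (hs : s ∈ Icc (0 : ℝ) 1)
    (ht : t ∈ Icc (0 : ℝ) 1) : dist (p.onEdge s) (p.onEdge t) = |s - t| * p.len := by
  rw [dist_eq_pathDist, pathDist, if_pos ⟨rfl, rfl⟩, p.onEdge_t hs, p.onEdge_t ht]
  rfl

theorem onEdge_self (p : GraphPoint G hG) : p.onEdge p.t = p := by
  have h := p.onEdge_t p.ht
  cases p
  simp only [onEdge, mk.injEq, true_and] at h ⊢
  exact h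

end GraphPoint

namespace GraphRealization

open GraphPoint

variable {V : Type*} {G : SimpleGraph V} {hG : G.Connected}

/-- A vertex, as a point of the realization. -/
def vertex (hG : G.Connected) (w : V) : GraphRealization G hG :=
  SeparationQuotient.mk (GraphPoint.vertex hG w)

theorem dist_vertex_vertex (v w : V) : dist (vertex hG v) (vertex hG w) = G.dist v w :=
  GraphPoint.dist_vertex_vertex v w

theorem mk_eq_of_dist_eq_zero {p q : GraphPoint G hG} (h : dist p q = 0) :
    SeparationQuotient.mk p = SeparationQuotient.mk q :=
  SeparationQuotient.mk_eq_mk.2 (Metric.inseparable_iff.2 h)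

theorem mk_eq_vertex_u {p : GraphPoint G hG} (h : p.t = 0) :
    SeparationQuotient.mk p = vertex hG p.u :=
  mk_eq_of_dist_eq_zero (le_antisymm (by simpa [h] using p.dist_vertex_u_le) dist_nonneg)

theorem mk_eq_vertex_v {p : GraphPoint G hG} (h : p.t = 1) :
    SeparationQuotient.mk p = vertex hG p.v :=
  mk_eq_of_dist_eq_zero (le_antisymm (by simpa [h] using p.dist_vertex_v_le) dist_nonneg)

theorem exists_dist_vertex_le (x : GraphRealization G hG) : ∃ w : V, dist x (vertex hG w) ≤ 1 := by
  obtain ⟨p, rfl⟩ := SeparationQuotient.surjective_mk x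
  refine ⟨p.u, p.dist_vertex_u_le.trans ?_⟩
  nlinarith [p.ht.1, p.ht.2, p.len_nonneg, p.len_le_one]

theorem exists_segment_onEdge (p : GraphPoint G hG) {s t : ℝ} (hs : s ∈ Icc (0 : ℝ) 1)
    (ht : t ∈ Icc (0 : ℝ) 1) :
    ∃ A, IsGeodesicSegment (SeparationQuotient.mk (p.onEdge s))
      (SeparationQuotient.mk (p.onEdge t)) A := by
  by_cases hp : p.u = p.v
  · have : dist (p.onEdge s) (p.onEdge t) = 0 := by
      rw [p.dist_onEdge hs ht, len_eq_zero hp, mul_zero]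
    rw [mk_eq_of_dist_eq_zero this]
    exact ⟨_, IsGeodesicSegment.singleton _⟩
  · have hc : ∀ s ∈ Icc (0 : ℝ) 1, ∀ t ∈ Icc (0 : ℝ) 1,
        dist (SeparationQuotient.mk (p.onEdge s)) (SeparationQuotient.mk (p.onEdge t)) =
          |s - t| := by
      intro s hs t ht
      rw [SeparationQuotient.dist_mk, p.dist_onEdge hs ht, len_eq_one hp, mul_one]
    rcases le_total s t with h | h
    · exact ⟨_, IsGeodesicSegment.image_Icc
        (c := fun s => SeparationQuotient.mk (p.onEdge s)) hc hs.1 h ht.2⟩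
    · exact ⟨_, (IsGeodesicSegment.image_Icc
        (c := fun s => SeparationQuotient.mk (p.onEdge s)) hc ht.1 h hs.2).symm⟩

theorem exists_segment_vertex_u (p : GraphPoint G hG) :
    ∃ A, IsGeodesicSegment (SeparationQuotient.mk p) (vertex hG p.u) A := by
  have := exists_segment_onEdge p p.ht (t := 0) (by simp)
  rwa [p.onEdge_self, mk_eq_vertex_u (p := p.onEdge 0) (p.onEdge_t (by simp))] at this

theorem exists_segment_vertex_v (p : GraphPoint G hG) :
    ∃ A, IsGeodesicSegment (SeparationQuotient.mk p) (vertex hG p.v) A := by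
  have := exists_segment_onEdge p p.ht (t := 1) (by simp)
  rwa [p.onEdge_self, mk_eq_vertex_v (p := p.onEdge 1) (p.onEdge_t (by simp))] at this

theorem exists_segment_vertex_vertex (w : V) (n : ℕ) : ∀ v : V, G.dist v w = n →
    ∃ A, IsGeodesicSegment (vertex hG v) (vertex hG w) A := by
  induction n with
  | zero =>
    intro v h
    rw [(hG v w).dist_eq_zero_iff.1 h]
    exact ⟨_, IsGeodesicSegment.singleton _⟩
  | succ n ih =>
    intro v h
    obtain ⟨W, hW⟩ := hG.exists_walk_length_eq_dist v w
    cases W with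
    | nil => simp at h
    | @cons _ x _ hadj W' =>
      have hx : G.dist x w = n := by
        have h1 := SimpleGraph.dist_le W'
        have h2 := hG.dist_triangle (u := v) (v := x) (w := w)
        rw [SimpleGraph.dist_eq_one_iff_adj.2 hadj] at h2
        simp only [SimpleGraph.Walk.length_cons] at hW
        omega
      obtain ⟨B, hB⟩ := ih x hx
      obtain ⟨A, hA⟩ := exists_segment_vertex_v (hG := hG) ⟨v, x, Or.inr hadj, 0, by simp⟩
      rw [mk_eq_vertex_u rfl] at hA
      refine hA.concat hB ?_
      simp only [dist_vertex_vertex]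
      rw [h, hx, SimpleGraph.dist_eq_one_iff_adj.2 hadj]
      push_cast; ring

theorem exists_segment_vertex (p : GraphPoint G hG) (w : V) :
    ∃ A, IsGeodesicSegment (SeparationQuotient.mk p) (vertex hG w) A := by
  have hd : dist (SeparationQuotient.mk p) (vertex hG w) = p.distVertex w := p.dist_vertex w
  rw [distVertex] at hd
  rcases min_cases (p.t * p.len + (G.dist p.u w : ℝ)) ((1 - p.t) * p.len + G.dist p.v w) with
    h | h <;> rw [h.1] at hd
  · obtain ⟨A, hA⟩ := exists_segment_vertex_u p
    obtain ⟨B, hB⟩ := exists_segment_vertex_vertex (hG := hG) w _ p.u rfl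
    refine hA.concat hB (le_antisymm ?_ (dist_triangle _ _ _))
    rw [hd, dist_vertex_vertex]
    exact add_le_add_left p.dist_vertex_u_le _
  · obtain ⟨A, hA⟩ := exists_segment_vertex_v p
    obtain ⟨B, hB⟩ := exists_segment_vertex_vertex (hG := hG) w _ p.v rfl
    refine hA.concat hB (le_antisymm ?_ (dist_triangle _ _ _))
    rw [hd, dist_vertex_vertex]
    exact add_le_add_left p.dist_vertex_v_le _

/-- Two points of one edge are joined along it, after reversing the edge if their parametrizations
disagree. Otherwise `exists_pathDist_ge` provides a vertex at which the triangle inequality is an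
equality, and two segments are concatenated there. -/
theorem isGeodesicSpace (G : SimpleGraph V) (hG : G.Connected) :
    IsGeodesicSpace (GraphRealization G hG) := by
  intro x y
  obtain ⟨p, rfl⟩ := SeparationQuotient.surjective_mk x
  obtain ⟨q, rfl⟩ := SeparationQuotient.surjective_mk y
  by_cases h : p.SameEdge q
  · obtain ⟨q', hq', hu, hv⟩ : ∃ q' : GraphPoint G hG,
        SeparationQuotient.mk q = SeparationQuotient.mk q' ∧ p.u = q'.u ∧ p.v = q'.v := by
      rcases h with h | h
      · exact ⟨q, rfl, h.1, h.2⟩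
      · refine ⟨⟨q.v, q.u, q.edge.imp Eq.symm SimpleGraph.Adj.symm, 1 - q.t,
          by linarith [q.ht.2], by linarith [q.ht.1]⟩, mk_eq_of_dist_eq_zero ?_, h.1, h.2⟩
        rw [dist_eq_pathDist, pathDist]
        by_cases e : q.u = q.v
        · simp [e, len_eq_zero e]
        · simp [e]
    have hq : p.onEdge q'.t = q' := by
      rw [← q'.onEdge_self]
      simp only [onEdge, hu, hv]
      simp
    have := exists_segment_onEdge p p.ht q'.ht
    rwa [p.onEdge_self, hq, ← hq'] at this
  · obtain ⟨w, hw⟩ := p.exists_pathDist_ge q h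
    obtain ⟨A, hA⟩ := exists_segment_vertex p w
    obtain ⟨B, hB⟩ := exists_segment_vertex q w
    refine hA.concat hB.symm (le_antisymm ?_ (dist_triangle _ _ _))
    rw [dist_comm (vertex hG w), vertex, SeparationQuotient.dist_mk, SeparationQuotient.dist_mk,
      GraphPoint.dist_vertex, GraphPoint.dist_vertex]
    exact hw

end GraphRealization

/-! ### Word lengths -/

section WordLength

variable {G : Type*} [Group G]

theorem mulCayley_dist_mul_left_le {S : Set G} (hS : Subgroup.closure S = ⊤) (d g h : G) :
    (SimpleGraph.mulCayley S).dist (d * g) (d * h) ≤ (SimpleGraph.mulCayley S).dist g h := by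
  obtain ⟨W, hW⟩ := (mulCayley_connected hS).exists_walk_length_eq_dist g h
  let f : SimpleGraph.mulCayley S →g SimpleGraph.mulCayley S :=
    ⟨fun x => d * x, fun h => SimpleGraph.mulCayley_adj_mul_iff_right.2 h⟩
  rw [← hW, ← SimpleGraph.Walk.length_map f W]
  exact SimpleGraph.dist_le (W.map f)

theorem mulCayley_dist_eq_wordLength {S : Set G} (hS : Subgroup.closure S = ⊤) (g h : G) :
    (SimpleGraph.mulCayley S).dist g h = wordLength S (g⁻¹ * h) := by
  refine le_antisymm ?_ ?_
  · simpa [wordLength] using mulCayley_dist_mul_left_le hS g 1 (g⁻¹ * h)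
  · simpa [wordLength] using mulCayley_dist_mul_left_le hS g⁻¹ g h

theorem wordLength_one (S : Set G) : wordLength S 1 = 0 := SimpleGraph.dist_self

theorem wordLength_mul_le {S : Set G} (hS : Subgroup.closure S = ⊤) (g h : G) :
    wordLength S (g * h) ≤ wordLength S g + wordLength S h := by
  have := (mulCayley_connected hS).dist_triangle (u := 1) (v := g) (w := g * h)
  rwa [mulCayley_dist_eq_wordLength hS g, inv_mul_cancel_left] at this

theorem wordLength_inv {S : Set G} (hS : Subgroup.closure S = ⊤) (g : G) :
    wordLength S g⁻¹ = wordLength S g := by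
  have := mulCayley_dist_eq_wordLength hS g 1
  rw [mul_one] at this
  rw [← this, SimpleGraph.dist_comm, wordLength]

open Classical in
/-- The ball of radius one for the word metric of `S`. -/
def unitBall (S : Finset G) : Finset G := insert 1 (S ∪ S⁻¹)

theorem one_mem_unitBall (S : Finset G) : 1 ∈ unitBall S := by simp [unitBall]

open Classical in
theorem inv_mul_mem_unitBall_pow {S : Finset G} {g h : G}
    (W : (SimpleGraph.mulCayley (S : Set G)).Walk g h) : g⁻¹ * h ∈ unitBall S ^ W.length := by
  induction W with
  | nil => simp
  | @cons a x b hadj W ih =>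
    rw [SimpleGraph.Walk.length_cons, pow_succ', show a⁻¹ * b = a⁻¹ * x * (x⁻¹ * b) by group]
    refine Finset.mul_mem_mul ?_ ih
    obtain ⟨-, s, hs, h | h⟩ := (SimpleGraph.mulCayley_adj' _ _ _).1 hadj
    · simp [unitBall, ← h, Finset.mem_coe.1 hs]
    · simp [unitBall, h, Finset.mem_coe.1 hs]

-- Balls are handled as powers of `unitBall S`, which makes the exponential bound on their
-- cardinality immediate.
open Classical in
theorem mem_unitBall_pow {S : Finset G} (hS : Subgroup.closure (S : Set G) = ⊤) {g : G} {n : ℕ}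
    (hn : wordLength (S : Set G) g ≤ n) : g ∈ unitBall S ^ n := by
  obtain ⟨W, hW⟩ := (mulCayley_connected hS).exists_walk_length_eq_dist 1 g
  have := inv_mul_mem_unitBall_pow W
  rw [inv_one, one_mul, hW] at this
  exact Finset.pow_subset_pow_right (one_mem_unitBall S) hn this

theorem countable_of_closure_eq_top {S : Finset G} (hS : Subgroup.closure (S : Set G) = ⊤) :
    Countable G := by
  classical
  rw [← Set.countable_univ_iff]
  refine (Set.countable_iUnion fun n : ℕ => (unitBall S ^ n).countable_toSet).mono fun g _ => ?_
  exact Set.mem_iUnion.2 ⟨_, mem_unitBall_pow hS le_rfl⟩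

/-- Word lengths for two finite generating sets are comparable. -/
theorem exists_wordLength_le_mul {S S' : Finset G} (hS : Subgroup.closure (S : Set G) = ⊤)
    (hS' : Subgroup.closure (S' : Set G) = ⊤) :
    ∃ C : ℕ, 0 < C ∧ ∀ g, wordLength (S' : Set G) g ≤ C * wordLength (S : Set G) g := by
  classical
  refine ⟨(unitBall S).sup (wordLength (S' : Set G)) + 1, by omega, fun g => ?_⟩
  have key : ∀ n : ℕ, ∀ g ∈ unitBall S ^ n,
      wordLength (S' : Set G) g ≤ (unitBall S).sup (wordLength (S' : Set G)) * n := by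
    intro n
    induction n with
    | zero => intro g hg; rw [pow_zero, Finset.mem_one] at hg; simp [hg, wordLength_one]
    | succ n ih =>
      intro g hg
      rw [pow_succ] at hg
      obtain ⟨x, hx, s, hs, rfl⟩ := Finset.mem_mul.1 hg
      refine (wordLength_mul_le hS' x s).trans ?_
      rw [Nat.mul_succ]
      exact add_le_add (ih x hx) (Finset.le_sup hs)
  refine (key _ g (mem_unitBall_pow hS le_rfl)).trans (Nat.mul_le_mul_right _ (by omega))

end WordLength

/-! ### Cocycles of measure equivalence couplings -/

section Coupling

variable {G H Ω : Type*} [Group G] [Group H] [MeasurableSpace Ω] [MulAction G Ω] [MulAction H Ω]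

theorem MeasureTheory.IsFundamentalDomain.ae_eq_of_smul_mem [Countable G] {μ : Measure Ω}
    {X : Set Ω} (hX : IsFundamentalDomain G X μ) :
    ∀ᵐ x ∂μ, ∀ g h : G, g • x ∈ X → h • x ∈ X → g = h := by
  rw [ae_all_iff]; intro g
  rw [ae_all_iff]; intro h
  by_cases e : g = h
  · simp [e]
  have := hX.aedisjoint (inv_injective.ne e)
  refine measure_mono_null (fun x hx => ?_) this
  simp only [mem_compl_iff, mem_ofPred_eq, Classical.not_imp] at hx
  exact ⟨Set.mem_inv_smul_set_iff.2 hx.1, Set.mem_inv_smul_set_iff.2 hx.2.1⟩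

/-- The points at which some value of the cocycle has length larger than `R`. -/
def tailSet (S : Set G) (X : Set Ω) (h : H) (R : ℝ) : Set Ω :=
  {y | ∃ g : G, R < wordLength S g ∧ g • h • y ∈ X}

/-- Since `tailSet` quantifies over all return elements, it is a countable union of preimages of X;
no measurability of `couplingCocycle` is needed. -/
theorem measurableSet_tailSet [Countable G] [MeasurableConstSMul G Ω] [MeasurableConstSMul H Ω]
    (S : Set G) {X : Set Ω} (hX : MeasurableSet X) (h : H) (R : ℝ) :
    MeasurableSet (tailSet S X h R) := by
  have : tailSet S X h R = ⋃ g : {g : G // R < wordLength S g},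
      (fun y => g.1 • h • y) ⁻¹' X := by
    ext y; simp [tailSet]
  rw [this]
  exact MeasurableSet.iUnion fun g =>
    ((measurable_const_smul g.1).comp (measurable_const_smul h)) hX

/-- The action of `H` on `X ≃ Ω / G` preserves the measure. -/
theorem MeasureTheory.IsFundamentalDomain.measure_exists_smul_mem_le [Countable G]
    [MeasurableConstSMul G Ω] [MeasurableConstSMul H Ω] [SMulCommClass H G Ω] {μ : Measure Ω}
    [SMulInvariantMeasure G Ω μ] [SMulInvariantMeasure H Ω μ] {X E : Set Ω}
    (hX : IsFundamentalDomain G X μ) (hXm : MeasurableSet X) (hE : MeasurableSet E) (h : H) :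
    μ {x ∈ X | ∃ g : G, g • h • x ∈ X ∩ E} ≤ μ (X ∩ E) := by
  set E' : Set Ω := ⋃ g : G, (fun z => g • z) ⁻¹' (X ∩ E) with hE'
  -- E' is the G-saturation of X ∩ E. Because the actions commute, h • X is again a fundamental
  -- domain for G, so the invariant set E' has the same measure in h • X as in X, and E' ∩ X is
  -- almost everywhere contained in X ∩ E.
  have hE'm : MeasurableSet E' :=
    MeasurableSet.iUnion fun g => (measurable_const_smul g) (hXm.inter hE)
  have hinv : ∀ g : G, (fun x => g • x) ⁻¹' E' = E' := by
    intro g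
    ext x
    simp only [hE', mem_preimage, mem_iUnion]
    constructor
    · rintro ⟨k, hk⟩; exact ⟨k * g, by rwa [mul_smul]⟩
    · rintro ⟨k, hk⟩; exact ⟨k * g⁻¹, by rwa [mul_smul, inv_smul_smul]⟩
  have e1 : {x ∈ X | ∃ g : G, g • h • x ∈ X ∩ E} = (fun x => h • x) ⁻¹' (E' ∩ h • X) := by
    ext x
    simp only [hE', mem_ofPred_eq, mem_preimage, mem_inter_iff, mem_iUnion,
      Set.smul_mem_smul_set_iff]
    tauto
  rw [e1, measure_preimage_smul, (hX.smul_of_comm h).measure_set_eq hX hE'm hinv]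
  refine measure_mono_ae ?_
  filter_upwards [hX.ae_eq_of_smul_mem] with x hx
  rintro ⟨hxE, hxX⟩
  obtain ⟨g, hg⟩ := mem_iUnion.1 hxE
  have := hx g 1 hg.1 (by rwa [one_smul])
  subst this
  have hg' : (1 : G) • x ∈ X ∩ E := hg
  rwa [one_smul] at hg'

/-- Markov's inequality for the cocycle. -/
theorem mul_measure_tailSet_le_lintegral [Countable G] [MeasurableConstSMul G Ω]
    [MeasurableConstSMul H Ω] {μ : Measure Ω} [SMulInvariantMeasure H Ω μ] {X : Set Ω}
    (hX : IsFundamentalDomain G X μ) (hXm : MeasurableSet X) (S : Set G) {φ : ℝ → ℝ}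
    (hφ : MonotoneOn φ (Ici 0)) {c R : ℝ} (hc : 0 < c) (hR : 0 ≤ R) (h : H) :
    ENNReal.ofReal (φ (R / c)) * μ (X ∩ tailSet S X h R) ≤
      ∫⁻ x in X, ENNReal.ofReal (φ (wordLength S (couplingCocycle G X h x) / c)) ∂μ := by
  have hT := measurableSet_tailSet S hXm h R
  have hq := (measurePreserving_smul h μ).quasiMeasurePreserving.ae hX.ae_eq_of_smul_mem
  calc ENNReal.ofReal (φ (R / c)) * μ (X ∩ tailSet S X h R)
      = ∫⁻ x in X, (tailSet S X h R).indicator (fun _ => ENNReal.ofReal (φ (R / c))) x ∂μ := by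
        rw [lintegral_indicator_const hT, Measure.restrict_apply hT, inter_comm]
    _ ≤ _ := by
        refine lintegral_mono_ae (ae_restrict_of_ae ?_)
        filter_upwards [hq] with x hx
        by_cases hxT : x ∈ tailSet S X h R
        · rw [indicator_of_mem hxT]
          obtain ⟨g, hg, hgx⟩ := hxT
          have hspec : couplingCocycle G X h x • h • x ∈ X :=
            Classical.epsilon_spec (p := fun l : G => l • h • x ∈ X) ⟨g, hgx⟩
          rw [hx _ _ hspec hgx]
          refine ENNReal.ofReal_le_ofReal (hφ ?_ ?_ ?_)
          · exact div_nonneg hR hc.le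
          · exact div_nonneg (Nat.cast_nonneg _) hc.le
          · gcongr
        · rw [indicator_of_notMem hxT]; exact zero_le

end Coupling

/-! ### Maps from Λ to Γ obtained from a point of the coupling. -/

section TwoGroups

variable {Γ Λ Ω : Type*} [Group Γ] [Group Λ] [MulAction Γ Ω] [MulAction Λ Ω]

open Classical in
/-- The points of `XΓ` near which the cocycle of `XΛ` has a value of length larger than `K`. -/
def localTailSet (S : Finset Γ) (S' : Finset Λ) (XΛ : Set Ω) (ρ : ℕ) (K : ℝ) : Set Ω :=
  ⋃ γ ∈ unitBall S ^ ρ, ⋃ s ∈ unitBall S, ⋃ l : Λ,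
    (fun y => l • γ⁻¹ • y) ⁻¹' (XΛ ∩ tailSet (S' : Set Λ) XΛ s⁻¹ K)

-- Reading g as a word of length n, each letter changes the return element to XΛ by at most K as
-- long as the word stays in the ball of radius ρ.
open Classical in
theorem wordLength_mul_inv_le_of_notMem_localTailSet {S : Finset Γ} {S' : Finset Λ}
    (hS' : Subgroup.closure (S' : Set Λ) = ⊤) [SMulCommClass Γ Λ Ω] {XΛ : Set Ω} {ρ : ℕ} {K : ℝ}
    {y : Ω} (hy : y ∉ localTailSet S S' XΛ ρ K) (hcov : ∀ γ : Γ, ∃ l : Λ, l • γ⁻¹ • y ∈ XΛ)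
    {l₀ : Λ} (hl₀ : l₀ • y ∈ XΛ) {n : ℕ} (hn : n ≤ ρ) :
    ∀ g ∈ unitBall S ^ n, ∀ l : Λ, l • g⁻¹ • y ∈ XΛ →
      (wordLength (S' : Set Λ) (l * l₀⁻¹) : ℝ) ≤ (n + 1) * K := by
  have step : ∀ g ∈ unitBall S ^ ρ, ∀ s ∈ unitBall S, ∀ l l' : Λ, l • g⁻¹ • y ∈ XΛ →
      l' • (g * s)⁻¹ • y ∈ XΛ → (wordLength (S' : Set Λ) (l' * l⁻¹) : ℝ) ≤ K := by
    intro g hg s hs l l' hl hl'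
    by_contra! hlt
    refine hy (mem_iUnion₂.2 ⟨g, hg, mem_iUnion₂.2 ⟨s, hs, mem_iUnion.2 ⟨l, hl, l' * l⁻¹, hlt, ?_⟩⟩⟩)
    rw [smul_comm s⁻¹ l, mul_smul, inv_smul_smul]
    rwa [mul_inv_rev, mul_smul] at hl'
  have hone := one_mem_unitBall S
  induction n with
  | zero =>
    intro g hg l hl
    rw [pow_zero, Finset.mem_one] at hg
    subst hg
    -- Two return elements of y itself are compared through the trivial letter 1. This costs one
    -- more K, hence n + 1, and avoids any uniqueness assumption at y.
    have := step 1 (Finset.pow_subset_pow_right hone hn (by simp)) 1 hone l₀ l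
      (by simpa using hl₀) (by simpa using hl)
    simpa using this
  | succ n ih =>
    intro g hg l hl
    rw [pow_succ] at hg
    obtain ⟨x, hx, s, hs, rfl⟩ := Finset.mem_mul.1 hg
    obtain ⟨l₁, hl₁⟩ := hcov x
    have h1 := ih (by omega) x hx l₁ hl₁
    have h2 := step x (Finset.pow_subset_pow_right hone (by omega) hx) s hs l₁ l hl₁ hl
    have h3 := wordLength_mul_le hS' (l * l₁⁻¹) (l₁ * l₀⁻¹)
    rw [show l * l₁⁻¹ * (l₁ * l₀⁻¹) = l * l₀⁻¹ by group] at h3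
    have h4 : (wordLength (S' : Set Λ) (l * l₀⁻¹) : ℝ) ≤
      wordLength (S' : Set Λ) (l * l₁⁻¹) + wordLength (S' : Set Λ) (l₁ * l₀⁻¹) := by
      exact_mod_cast h3
    push_cast
    linarith

variable [MeasurableSpace Ω]

-- Coboundedness moves XΓ into XΛ by finitely many translations; there each single event has the
-- measure of a tail by `measure_exists_smul_mem_le`. The rest is a union bound over the ball of Γ,
-- over F and over the letters.
open Classical in
theorem measure_inter_localTailSet_le [Countable Λ] [MeasurableConstSMul Γ Ω]
    [MeasurableConstSMul Λ Ω] [SMulCommClass Γ Λ Ω] {μ : Measure Ω} [SMulInvariantMeasure Γ Ω μ]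
    [SMulInvariantMeasure Λ Ω μ] {XΓ XΛ : Set Ω} (hX : IsFundamentalDomain Λ XΛ μ)
    (hXm : MeasurableSet XΛ) {F : Finset Λ} (hF : XΓ ⊆ (F : Set Λ) • XΛ) (S : Finset Γ)
    (S' : Finset Λ) (ρ : ℕ) (K : ℝ) :
    μ (XΓ ∩ localTailSet S S' XΛ ρ K) ≤
      ((unitBall S).card ^ ρ : ℕ) * (F.card *
        ∑ s ∈ unitBall S, μ (XΛ ∩ tailSet (S' : Set Λ) XΛ s⁻¹ K)) := by
  set B : Γ → Γ → Set Ω := fun γ s =>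
    {x ∈ XΛ | ∃ l : Λ, l • γ⁻¹ • x ∈ XΛ ∩ tailSet (S' : Set Λ) XΛ s⁻¹ K} with hB
  have hsub : XΓ ∩ localTailSet S S' XΛ ρ K ⊆
      ⋃ γ ∈ unitBall S ^ ρ, ⋃ f ∈ F, ⋃ s ∈ unitBall S, (fun y => f⁻¹ • y) ⁻¹' B γ s := by
    rintro y ⟨hy, hyT⟩
    simp only [localTailSet, mem_iUnion] at hyT ⊢
    obtain ⟨γ, hγ, s, hs, l, hl⟩ := hyT
    obtain ⟨f, hf, x, hx, rfl⟩ := hF hy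
    refine ⟨γ, hγ, f, hf, s, hs, ?_⟩
    simp only [mem_preimage, inv_smul_smul]
    refine ⟨hx, l * f, ?_⟩
    rw [mul_smul, ← smul_comm γ⁻¹ f x]
    exact hl
  calc μ (XΓ ∩ localTailSet S S' XΛ ρ K)
      ≤ ∑ γ ∈ unitBall S ^ ρ, ∑ f ∈ F, ∑ s ∈ unitBall S,
          μ (XΛ ∩ tailSet (S' : Set Λ) XΛ s⁻¹ K) := by
        refine (measure_mono hsub).trans ((measure_biUnion_finset_le _ _).trans
          (Finset.sum_le_sum fun γ _ => (measure_biUnion_finset_le _ _).trans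
          (Finset.sum_le_sum fun f _ => (measure_biUnion_finset_le _ _).trans
          (Finset.sum_le_sum fun s _ => ?_))))
        rw [measure_preimage_smul]
        exact hX.measure_exists_smul_mem_le hXm (measurableSet_tailSet _ hXm _ _) γ⁻¹
    _ ≤ _ := by
        rw [Finset.sum_const, Finset.sum_const, nsmul_eq_mul, nsmul_eq_mul]
        gcongr
        exact Finset.card_pow_le

open Classical in
/-- If the tails of the cocycles are small, then there is a map `b : Λ → Γ` with small jumps along
a given finite set `T`, and whose inverse is controlled along `T`. -/
theorem exists_map_of_measure_tails_lt [Countable Γ] [Countable Λ] [StandardBorelSpace Ω]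
    [MeasurableConstSMul Γ Ω] [MeasurableConstSMul Λ Ω] [SMulCommClass Γ Λ Ω] {μ : Measure Ω}
    [SMulInvariantMeasure Γ Ω μ] [SMulInvariantMeasure Λ Ω μ] {XΓ XΛ : Set Ω}
    (hcoupling : IsMECoupling Γ Λ μ XΓ XΛ) {F : Finset Λ} (hF : XΓ ⊆ (F : Set Λ) • XΛ)
    {S : Finset Γ} {S' : Finset Λ} (hS : Subgroup.closure (S : Set Γ) = ⊤)
    (hS' : Subgroup.closure (S' : Set Λ) = ⊤) {r ρ d : ℕ} {K : ℝ} {T : Finset Λ}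
    (hT : T.card * (∑ s ∈ unitBall S' ^ d, μ (XΓ ∩ tailSet (S : Set Γ) XΓ s⁻¹ r) +
      ((unitBall S).card ^ ρ : ℕ) * (F.card *
        ∑ s ∈ unitBall S, μ (XΛ ∩ tailSet (S' : Set Λ) XΛ s⁻¹ K))) < μ XΓ) :
    ∃ b : Λ → Γ,
      (∀ l ∈ T, ∀ l', wordLength (S' : Set Λ) (l⁻¹ * l') ≤ d →
        wordLength (S : Set Γ) ((b l)⁻¹ * b l') ≤ r) ∧
      ∀ l ∈ T, ∀ l', wordLength (S : Set Γ) ((b l)⁻¹ * b l') ≤ ρ →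
        (wordLength (S' : Set Λ) (l⁻¹ * l') : ℝ) ≤
          (ρ + 1) * K + 2 * F.sup (wordLength (S' : Set Λ)) := by
  have hΓ := hcoupling.fundamental_left
  have hΛ := hcoupling.fundamental_right
  have hΓm := hcoupling.measurable_left
  have hΛm := hcoupling.measurable_right
  have : SMulCommClass Λ Γ Ω := SMulCommClass.symm Γ Λ Ω
  set E₁ : Set Ω := ⋃ s ∈ unitBall S' ^ d, tailSet (S : Set Γ) XΓ s⁻¹ r with hE₁
  set E₂ : Set Ω := localTailSet S S' XΛ ρ K with hE₂
  have hE₁m : MeasurableSet E₁ := Finset.measurableSet_biUnion _ fun s _ =>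
    measurableSet_tailSet _ hΓm _ _
  have hE₂m : MeasurableSet E₂ := Finset.measurableSet_biUnion _ fun γ _ =>
    Finset.measurableSet_biUnion _ fun s _ => MeasurableSet.iUnion fun l =>
    ((measurable_const_smul l).comp (measurable_const_smul γ⁻¹))
      (hΛm.inter (measurableSet_tailSet _ hΛm _ _))
  -- E₁ ∪ E₂ is the bad set. Translating by each l⁻¹ with l in T and returning to XΓ does not
  -- increase its measure, so some generic x has all these translates good.
  have hbound : μ (⋃ l ∈ T, {x ∈ XΓ | ∃ γ : Γ, γ • l⁻¹ • x ∈ XΓ ∩ (E₁ ∪ E₂)}) < μ XΓ := by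
    refine lt_of_le_of_lt ?_ hT
    refine (measure_biUnion_finset_le _ _).trans ((Finset.sum_le_card_nsmul _ _ _ fun l _ =>
      (hΓ.measure_exists_smul_mem_le hΓm (hE₁m.union hE₂m) l⁻¹).trans ?_).trans_eq
      (nsmul_eq_mul _ _))
    rw [inter_union_distrib_left]
    refine (measure_union_le _ _).trans (add_le_add ?_ ?_)
    · rw [hE₁, inter_iUnion₂]
      exact measure_biUnion_finset_le _ _
    · exact measure_inter_localTailSet_le hΛ hΛm hF S S' ρ K
  have hcov₁ : ∀ᵐ x ∂μ, ∀ l : Λ, ∃ γ : Γ, γ • l⁻¹ • x ∈ XΓ := by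
    rw [ae_all_iff]; intro l
    exact (measurePreserving_smul l⁻¹ μ).quasiMeasurePreserving.ae hΓ.ae_covers
  have hcov₂ : ∀ᵐ x ∂μ, ∀ γ : Γ, ∃ l : Λ, l • γ⁻¹ • x ∈ XΛ := by
    rw [ae_all_iff]; intro γ
    exact (measurePreserving_smul γ⁻¹ μ).quasiMeasurePreserving.ae hΛ.ae_covers
  obtain ⟨x, hxX, hx₁, hx₂, hxT⟩ : ∃ x ∈ XΓ, (∀ l : Λ, ∃ γ : Γ, γ • l⁻¹ • x ∈ XΓ) ∧
      (∀ γ : Γ, ∃ l : Λ, l • γ⁻¹ • x ∈ XΛ) ∧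
      x ∉ ⋃ l ∈ T, {x ∈ XΓ | ∃ γ : Γ, γ • l⁻¹ • x ∈ XΓ ∩ (E₁ ∪ E₂)} := by
    by_contra! hcon
    refine absurd hbound (not_lt.2 (measure_mono_ae ?_))
    filter_upwards [hcov₁, hcov₂] with x h₁ h₂ hxX
    exact hcon x hxX h₁ h₂
  choose β hβ using hx₁
  have hnot : ∀ l ∈ T, β l • l⁻¹ • x ∉ E₁ ∪ E₂ := fun l hl hmem =>
    hxT (mem_iUnion₂.2 ⟨l, hl, hxX, β l, hβ l, hmem⟩)
  -- With y = β l • l⁻¹ • x, the element β l' * (β l)⁻¹ returns (l⁻¹ * l')⁻¹ • y to XΓ. So the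
  -- increments of the inverses are governed by the cocycle at y, and only the base point l has to
  -- lie in T.
  refine ⟨fun l => (β l)⁻¹, fun l hl l' hll' => ?_, fun l hl l' hll' => ?_⟩
  · by_contra! hlt
    refine hnot l hl (Or.inl (mem_iUnion₂.2 ⟨l⁻¹ * l', mem_unitBall_pow hS' hll', β l' * (β l)⁻¹,
      ?_, ?_⟩))
    · rw [inv_inv, ← wordLength_inv hS, mul_inv_rev, inv_inv] at hlt
      exact_mod_cast hlt
    · rw [smul_comm (l⁻¹ * l')⁻¹ (β l), mul_smul, inv_smul_smul, ← mul_smul (l⁻¹ * l')⁻¹,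
        show (l⁻¹ * l')⁻¹ * l⁻¹ = l'⁻¹ by group]
      exact hβ l'
  · set y := β l • l⁻¹ • x with hy
    obtain ⟨f, hf, z, hz, hfz⟩ := hF (hβ l)
    obtain ⟨f', hf', z', hz', hfz'⟩ := hF (hβ l')
    have hcov : ∀ γ : Γ, ∃ m : Λ, m • γ⁻¹ • y ∈ XΛ := by
      intro γ
      obtain ⟨m, hm⟩ := hx₂ ((β l)⁻¹ * γ)
      refine ⟨m * l, ?_⟩
      rw [hy, smul_comm (β l) l⁻¹ x, smul_comm γ⁻¹ l⁻¹, mul_smul, smul_inv_smul]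
      simpa [mul_smul] using hm
    have h0 : f⁻¹ • y ∈ XΛ := by
      have : f • z = y := hfz
      rwa [← this, inv_smul_smul]
    -- Both y and its analogue for l' lie in XΓ, hence in f • XΛ and f' • XΛ. Comparing the two
    -- return elements to XΛ recovers l⁻¹ * l' up to the factors f and f'.
    have h1 : (f'⁻¹ * l'⁻¹ * l) • ((β l)⁻¹⁻¹ * (β l')⁻¹)⁻¹ • y ∈ XΛ := by
      have : f' • z' = β l' • l'⁻¹ • x := hfz'
      rw [← inv_smul_eq_iff.2 this.symm] at hz'
      convert hz' using 1
      rw [hy, inv_inv, mul_inv_rev, inv_inv, mul_smul (β l'), inv_smul_smul, mul_smul, mul_smul,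
        smul_comm (β l') l⁻¹ x, smul_inv_smul, smul_comm l'⁻¹ (β l') x]
    have key := wordLength_mul_inv_le_of_notMem_localTailSet hS'
      (fun h => hnot l hl (Or.inr h)) hcov h0 le_rfl _ (mem_unitBall_pow hS hll') _ h1
    have hfl : wordLength (S' : Set Λ) f ≤ F.sup (wordLength (S' : Set Λ)) :=
      Finset.le_sup (Finset.mem_coe.1 hf)
    have hfl' : wordLength (S' : Set Λ) f' ≤ F.sup (wordLength (S' : Set Λ)) :=
      Finset.le_sup (Finset.mem_coe.1 hf')
    have e : l⁻¹ * l' = f * ((f'⁻¹ * l'⁻¹ * l) * f⁻¹⁻¹)⁻¹ * f'⁻¹ := by group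
    have h2 : wordLength (S' : Set Λ) (l⁻¹ * l') ≤ wordLength (S' : Set Λ) f +
        wordLength (S' : Set Λ) ((f'⁻¹ * l'⁻¹ * l) * f⁻¹⁻¹) + wordLength (S' : Set Λ) f' := by
      conv_lhs => rw [e]
      refine (wordLength_mul_le hS' _ _).trans ?_
      rw [wordLength_inv hS' f']
      refine Nat.add_le_add_right ((wordLength_mul_le hS' _ _).trans ?_) _
      rw [wordLength_inv hS']
    have h3 : (wordLength (S' : Set Λ) (l⁻¹ * l') : ℝ) ≤
        (F.sup (wordLength (S' : Set Λ)) : ℕ) +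
        wordLength (S' : Set Λ) ((f'⁻¹ * l'⁻¹ * l) * f⁻¹⁻¹) +
        (F.sup (wordLength (S' : Set Λ)) : ℕ) := by
      exact_mod_cast h2.trans (by omega)
    linarith

end TwoGroups

/-! ### Asymptotics of the tails -/

open Filter Topology in
/-- The choice of the scale: `r` is a power of `n` with exponent between `q / (1 + q)` and
`p / (1 + p)`. -/
theorem exists_scale {p q : ℝ} (hq : 0 < q) (hpq : q < p) {C₁ C₂ C₃ D L m₀ ε : ℝ} (hC₁ : 0 ≤ C₁)
    (hC₂ : 0 ≤ C₂) (hL : 0 ≤ L) (hm₀ : 0 < m₀) (hε : 0 < ε) :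
    ∃ n₀ : ℕ, ∀ n ≥ n₀, ∃ r : ℕ, 1 ≤ r ∧ D * (Nat.log 2 n + 2) + 1 ≤ r ∧
      4 * n * (C₁ * (r : ℝ) ^ (-(1 + 1 / q)) + C₂ * Real.exp (-r)) < m₀ ∧
      (4 * r + 1) * (L * (r : ℝ) ^ (1 / p)) + C₃ ≤ ε * n := by
  have hp : 0 < p := hq.trans hpq
  have hpq' : 1 / p < 1 / q := one_div_lt_one_div_of_lt hq hpq
  have hp' : 0 < 1 / p := by positivity
  obtain ⟨θ, hθ₁, hθ₂⟩ := exists_between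
    (show 1 / (1 + 1 / q) < 1 / (1 + 1 / p) from one_div_lt_one_div_of_lt (by linarith)
      (by linarith))
  have hθ : 0 < θ := lt_trans (by positivity) hθ₁
  -- For r of order n^θ, `ha` makes n · r^(-(1+1/q)) tend to 0 and `hb` makes r^(1+1/p) = o(n); θ >
  -- 0 suffices for the logarithmic and exponential terms.
  have ha : 1 < θ * (1 + 1 / q) := by rwa [div_lt_iff₀ (by positivity)] at hθ₁
  have hb : θ * (1 + 1 / p) < 1 := by rwa [lt_div_iff₀ (by positivity)] at hθ₂
  have hpow : Tendsto (fun x : ℝ => x ^ θ) atTop atTop := tendsto_rpow_atTop hθ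
  have l₁ : Tendsto (fun x : ℝ => x ^ (-(θ * (1 + 1 / q) - 1))) atTop (𝓝 0) :=
    tendsto_rpow_neg_atTop (by linarith)
  have l₂ : Tendsto (fun x : ℝ => (x ^ θ) ^ (1 / θ) * Real.exp (-1 * x ^ θ)) atTop (𝓝 0) :=
    (tendsto_rpow_mul_exp_neg_mul_atTop_nhds_zero (1 / θ) 1 one_pos).comp hpow
  have l₃ : Tendsto (fun x : ℝ => x ^ (-(1 - θ * (1 + 1 / p)))) atTop (𝓝 0) :=
    tendsto_rpow_neg_atTop (by linarith)
  have l₄ : Tendsto (fun x : ℝ => Real.log x / x ^ θ) atTop (𝓝 0) :=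
    (isLittleO_log_rpow_atTop hθ).tendsto_div_nhds_zero
  have l₅ : Tendsto (fun x : ℝ => (x ^ θ)⁻¹) atTop (𝓝 0) := hpow.inv_tendsto_atTop
  have e₁ : ∀ᶠ x : ℝ in atTop, 4 * (C₁ * x ^ (-(θ * (1 + 1 / q) - 1)) +
      C₂ * ((x ^ θ) ^ (1 / θ) * Real.exp (-1 * x ^ θ))) < m₀ := by
    have := ((l₁.const_mul C₁).add (l₂.const_mul C₂)).const_mul 4
    simp only [mul_zero, add_zero] at this
    exact this.eventually (gt_mem_nhds hm₀)
  have e₂ : ∀ᶠ x : ℝ in atTop, 5 * L * 2 ^ (1 + 1 / p) * x ^ (-(1 - θ * (1 + 1 / p))) + C₃ * x⁻¹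
      < ε := by
    have := (l₃.const_mul (5 * L * 2 ^ (1 + 1 / p))).add (tendsto_inv_atTop_zero.const_mul C₃)
    simp only [mul_zero, add_zero] at this
    exact this.eventually (gt_mem_nhds hε)
  have e₃ : ∀ᶠ x : ℝ in atTop, |D| * (1 / Real.log 2) * (Real.log x / x ^ θ) +
      (|D| * 2 + 1) * (x ^ θ)⁻¹ < 1 := by
    have := (l₄.const_mul (|D| * (1 / Real.log 2))).add (l₅.const_mul (|D| * 2 + 1))
    simp only [mul_zero, add_zero] at this
    exact this.eventually (gt_mem_nhds one_pos)
  have e := (tendsto_natCast_atTop_atTop (R := ℝ)).eventually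
    ((e₁.and (e₂.and (e₃.and (eventually_ge_atTop (1 : ℝ))))))
  obtain ⟨n₀, hn₀⟩ := eventually_atTop.1 e
  refine ⟨n₀, fun n hn => ?_⟩
  obtain ⟨h₁, h₂, h₃, hx⟩ := hn₀ n hn
  set x : ℝ := (n : ℝ) with hxdef
  have hx0 : 0 < x := by linarith
  have hxθ : 1 ≤ x ^ θ := Real.one_le_rpow hx hθ.le
  have hle : x ^ θ ≤ ⌈x ^ θ⌉₊ := Nat.le_ceil _
  have hge : (⌈x ^ θ⌉₊ : ℝ) ≤ 2 * x ^ θ := by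
    linarith [Nat.ceil_lt_add_one (show 0 ≤ x ^ θ by linarith)]
  set r := ⌈x ^ θ⌉₊ with hr
  have hr1 : (1 : ℝ) ≤ r := hxθ.trans hle
  refine ⟨r, by exact_mod_cast hr1, ?_, ?_, ?_⟩
  · have hlog : (Nat.log 2 n : ℝ) ≤ Real.log x * (1 / Real.log 2) := by
      have := Real.natLog_le_logb n 2
      rwa [Real.logb, div_eq_mul_one_div] at this
    have h3 : |D| * (1 / Real.log 2) * Real.log x + (|D| * 2 + 1) < x ^ θ := by
      have := mul_lt_mul_of_pos_right h₃ (show 0 < x ^ θ by linarith)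
      have ne : x ^ θ ≠ 0 := by linarith
      calc _ = (|D| * (1 / Real.log 2) * (Real.log x / x ^ θ) + (|D| * 2 + 1) * (x ^ θ)⁻¹) * x ^ θ
          := by field_simp
        _ < _ := by linarith
    have h4 : D * (Nat.log 2 n + 2) ≤ |D| * (Real.log x * (1 / Real.log 2) + 2) :=
      mul_le_mul (le_abs_self D) (by linarith) (by positivity) (abs_nonneg _)
    linarith
  · refine lt_of_le_of_lt ?_ h₁
    have k₁ : x * (r : ℝ) ^ (-(1 + 1 / q)) ≤ x ^ (-(θ * (1 + 1 / q) - 1)) := by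
      calc x * (r : ℝ) ^ (-(1 + 1 / q)) ≤ x * (x ^ θ) ^ (-(1 + 1 / q)) := by
            refine mul_le_mul_of_nonneg_left
              (Real.rpow_le_rpow_of_nonpos (by linarith) hle ?_) hx0.le
            have : 0 < 1 / q := by positivity
            linarith
        _ = x ^ (-(θ * (1 + 1 / q) - 1)) := by
            rw [← Real.rpow_mul hx0.le]
            nth_rewrite 1 [← Real.rpow_one x]
            rw [← Real.rpow_add hx0]
            congr 1; ring
    have k₂ : x * Real.exp (-r) ≤ (x ^ θ) ^ (1 / θ) * Real.exp (-1 * x ^ θ) := by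
      rw [← Real.rpow_mul hx0.le, mul_one_div_cancel hθ.ne', Real.rpow_one]
      gcongr
      linarith
    nlinarith [mul_le_mul_of_nonneg_left k₁ hC₁, mul_le_mul_of_nonneg_left k₂ hC₂]
  · have k₁ : (4 * r + 1) * (L * (r : ℝ) ^ (1 / p)) ≤
        5 * L * 2 ^ (1 + 1 / p) * x ^ (-(1 - θ * (1 + 1 / p))) * x := by
      calc (4 * r + 1) * (L * (r : ℝ) ^ (1 / p)) ≤ (5 * r) * (L * (r : ℝ) ^ (1 / p)) := by
            gcongr; linarith
        _ = 5 * L * (r : ℝ) ^ (1 + 1 / p) := by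
            rw [Real.rpow_add (by linarith), Real.rpow_one]; ring
        _ ≤ 5 * L * (2 * x ^ θ) ^ (1 + 1 / p) := by gcongr
        _ = 5 * L * 2 ^ (1 + 1 / p) * x ^ (-(1 - θ * (1 + 1 / p))) * x := by
            rw [Real.mul_rpow zero_le_two (by linarith), ← Real.rpow_mul hx0.le]
            nth_rewrite 3 [← Real.rpow_one x]
            rw [mul_assoc (5 * L * 2 ^ (1 + 1 / p)), ← Real.rpow_add hx0, ← mul_assoc]
            congr 2; ring
    have := mul_lt_mul_of_pos_right h₂ hx0
    rw [add_mul, mul_assoc C₃, inv_mul_cancel₀ hx0.ne'] at this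
    linarith

theorem ENNReal.le_ofReal_div_of_ofReal_mul_le {v : ℝ} {m I : ℝ≥0∞} (hv : 0 < v) (hI : I < ∞)
    (h : ENNReal.ofReal v * m ≤ I) : m ≤ ENNReal.ofReal (I.toReal / v) := by
  rw [ENNReal.ofReal_div_of_pos hv, ENNReal.ofReal_toReal hI.ne,
    ENNReal.le_div_iff_mul_le (Or.inl (by simpa using hv)) (Or.inl ENNReal.ofReal_ne_top), mul_comm]
  exact h

section Tails

variable {G H Ω : Type*} [Group G] [Group H] [MeasurableSpace Ω] [MulAction G Ω] [MulAction H Ω]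
  [Countable G] [MeasurableConstSMul G Ω] [MeasurableConstSMul H Ω] {μ : Measure Ω}
  [SMulInvariantMeasure H Ω μ] {X : Set Ω}

/-- Tails of the cocycle under a moment condition. -/
theorem exists_sum_tail_le_rpow (hX : IsFundamentalDomain G X μ) (hXm : MeasurableSet X) {a : ℝ}
    (ha : 0 < a) (hint : IsPhiIntegrable H G (fun t => t ^ a) μ X) {S : Finset G}
    (hS : Subgroup.closure (S : Set G) = ⊤) (A : Finset H) :
    ∃ C : ℝ, 0 ≤ C ∧ ∀ r : ℕ, 1 ≤ r →
      ∑ s ∈ A, μ (X ∩ tailSet (S : Set G) X s⁻¹ r) ≤ ENNReal.ofReal (C * (r : ℝ) ^ (-a)) := by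
  obtain ⟨S₀, hS₀, hint⟩ := hint
  obtain ⟨N, hN, hle⟩ := exists_wordLength_le_mul hS₀ hS
  choose c hc hI using hint
  have hNc : ∀ h, 0 < N * c h := fun h => mul_pos (by exact_mod_cast hN) (hc h)
  refine ⟨∑ s ∈ A, (∫⁻ x in X, ENNReal.ofReal
    ((wordLength (S₀ : Set G) (couplingCocycle G X s⁻¹ x) / c s⁻¹) ^ a) ∂μ).toReal *
      (N * c s⁻¹) ^ a, ?_, fun r hr => ?_⟩
  · exact Finset.sum_nonneg fun s _ => mul_nonneg ENNReal.toReal_nonneg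
      (Real.rpow_nonneg (hNc _).le _)
  have hr0 : (0 : ℝ) < r := by exact_mod_cast hr
  have hN0 : (0 : ℝ) < N := by exact_mod_cast hN
  rw [Finset.sum_mul, ENNReal.ofReal_sum_of_nonneg fun s _ => mul_nonneg
    (mul_nonneg ENNReal.toReal_nonneg (Real.rpow_nonneg (hNc _).le _)) (by positivity)]
  refine Finset.sum_le_sum fun s _ => ?_
  -- Changing the generating set rescales lengths by at most N, which only affects the constant.
  have hsub : tailSet (S : Set G) X s⁻¹ r ⊆ tailSet (S₀ : Set G) X s⁻¹ (r / N) := by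
    rintro y ⟨g, hg, hy⟩
    refine ⟨g, ?_, hy⟩
    rw [div_lt_iff₀ hN0, mul_comm]
    exact hg.trans_le (by exact_mod_cast hle g)
  refine (measure_mono (inter_subset_inter_right X hsub)).trans ?_
  have key := mul_measure_tailSet_le_lintegral hX hXm (S₀ : Set G) (φ := fun t => t ^ a)
    (fun x hx y _ hxy => Real.rpow_le_rpow hx hxy ha.le) (hc s⁻¹)
    (show 0 ≤ (r : ℝ) / N by positivity) s⁻¹
  have hpos : 0 < (r : ℝ) / N / c s⁻¹ := div_pos (by positivity) (hc _)
  refine (ENNReal.le_ofReal_div_of_ofReal_mul_le (Real.rpow_pos_of_pos hpos a) (hI s⁻¹)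
    key).trans_eq ?_
  rw [div_div, Real.div_rpow hr0.le (hNc _).le, Real.rpow_neg hr0.le]
  congr 1
  field_simp

/-- Tails of the cocycle under an exponential moment condition. -/
theorem exists_sum_tail_le_exp (hX : IsFundamentalDomain G X μ) (hXm : MeasurableSet X) {p : ℝ}
    (hp : 0 < p) {S : Set G}
    (hint : ∀ h : H, ∃ c : ℝ, 0 < c ∧ ∫⁻ x in X, ENNReal.ofReal
      (Real.exp ((wordLength S (couplingCocycle G X h x) / c) ^ p)) ∂μ < ∞) (A : Finset H)
    {M : ℝ} (hM : 0 ≤ M) :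
    ∃ L C : ℝ, 0 ≤ L ∧ 0 ≤ C ∧ ∀ r : ℕ,
      ∑ s ∈ A, μ (X ∩ tailSet S X s⁻¹ (L * (r : ℝ) ^ (1 / p))) ≤
        ENNReal.ofReal (C * Real.exp (-(M * r))) := by
  choose c hc hI using hint
  obtain ⟨c₀, hc₀, hle⟩ : ∃ c₀ : ℝ, 0 ≤ c₀ ∧ ∀ s ∈ A, c s⁻¹ ≤ c₀ :=
    ⟨∑ s ∈ A, c s⁻¹, Finset.sum_nonneg fun s _ => (hc _).le, fun s hs =>
      Finset.single_le_sum (f := fun s => c s⁻¹) (fun s _ => (hc _).le) hs⟩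
  -- L is chosen so that (L · r^(1/p) / c)^p ≥ M · r for every constant c involved: any exponential
  -- rate M is available at the price of a larger L.
  refine ⟨c₀ * M ^ (1 / p), ∑ s ∈ A, (∫⁻ x in X, ENNReal.ofReal
    (Real.exp ((wordLength S (couplingCocycle G X s⁻¹ x) / c s⁻¹) ^ p)) ∂μ).toReal, by positivity,
    Finset.sum_nonneg fun s _ => ENNReal.toReal_nonneg, fun r => ?_⟩
  rw [Finset.sum_mul, ENNReal.ofReal_sum_of_nonneg fun s _ => mul_nonneg ENNReal.toReal_nonneg
    (Real.exp_pos _).le]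
  refine Finset.sum_le_sum fun s hs => ?_
  have key := mul_measure_tailSet_le_lintegral hX hXm S (φ := fun t => Real.exp (t ^ p))
    (fun x hx y _ hxy => Real.exp_le_exp.2 (Real.rpow_le_rpow hx hxy hp.le)) (hc s⁻¹)
    (show 0 ≤ c₀ * M ^ (1 / p) * (r : ℝ) ^ (1 / p) by positivity) s⁻¹
  refine (ENNReal.le_ofReal_div_of_ofReal_mul_le (Real.exp_pos _) (hI s⁻¹) key).trans ?_
  refine ENNReal.ofReal_le_ofReal ?_
  rw [div_eq_mul_inv, ← Real.exp_neg]
  refine mul_le_mul_of_nonneg_left (Real.exp_le_exp.2 (neg_le_neg ?_)) ENNReal.toReal_nonneg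
  have h1 : M * r = (M ^ (1 / p) * (r : ℝ) ^ (1 / p)) ^ p := by
    rw [← Real.mul_rpow hM (Nat.cast_nonneg _), ← Real.rpow_mul (by positivity),
      one_div_mul_cancel hp.ne', Real.rpow_one]
  rw [h1]
  refine Real.rpow_le_rpow (by positivity) ?_ hp.le
  rw [le_div_iff₀ (hc _), mul_assoc c₀, mul_comm _ (c s⁻¹)]
  gcongr
  exact hle s hs

end Tails

/-! ### Coarse paths in the target group -/

theorem wordLength_inv_mul_le_of_steps {G : Type*} [Group G] {S : Set G}
    (hS : Subgroup.closure S = ⊤) {u : ℕ → G} {d i : ℕ} : ∀ j : ℕ, i ≤ j →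
    (∀ t < j, wordLength S ((u t)⁻¹ * u (t + 1)) ≤ d) →
    wordLength S ((u i)⁻¹ * u j) ≤ d * (j - i) := by
  intro j hij
  induction j, hij using Nat.le_induction with
  | base => intro _; simp [wordLength_one]
  | succ j hij ih =>
    intro h
    have h1 := ih fun t ht => h t (by omega)
    have h2 := h j (by omega)
    have h3 := wordLength_mul_le hS ((u i)⁻¹ * u j) ((u j)⁻¹ * u (j + 1))
    rw [show (u i)⁻¹ * u j * ((u j)⁻¹ * u (j + 1)) = (u i)⁻¹ * u (j + 1) by group] at h3
    rw [Nat.succ_sub hij, Nat.mul_succ]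
    omega

/-! ### Comparison of geodesics and paths of Λ through Γ. -/

section Main

variable {Γ Λ : Type*} [Group Γ] [Group Λ] {Ω : Type*} [MeasurableSpace Ω] [StandardBorelSpace Ω]
  [MulAction Γ Ω] [MulAction Λ Ω] [SMulCommClass Γ Λ Ω] [MeasurableConstSMul Γ Ω]
  [MeasurableConstSMul Λ Ω] {μ : Measure Ω} [SMulInvariantMeasure Γ Ω μ]
  [SMulInvariantMeasure Λ Ω μ] {XΓ XΛ : Set Ω}

/-- Maps from `Λ` to `Γ` with jumps at most `r` along a given finite set of `n` elements, and whose
inverse has sublinear distortion at scale `4 * r`. -/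
theorem exists_map_sublinear {p q : ℝ} (hq : 0 < q) (hpq : q < p)
    (hcoupling : IsMECoupling Γ Λ μ XΓ XΛ) (hcobounded : IsCobounded Λ XΓ XΛ)
    {S : Finset Γ} {S' : Finset Λ} (hS : Subgroup.closure (S : Set Γ) = ⊤)
    (hS' : Subgroup.closure (S' : Set Λ) = ⊤)
    (hφ : ∀ g : Γ, ∃ c : ℝ, 0 < c ∧ ∫⁻ x in XΛ, ENNReal.ofReal (Real.exp
      ((wordLength (S' : Set Λ) (couplingCocycle Λ XΛ g x) / c) ^ p)) ∂μ < ∞)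
    (hψ : IsPhiIntegrable Λ Γ (fun t => t ^ (1 + 1 / q)) μ XΓ) (d : ℕ) (D : ℝ) {ε : ℝ}
    (hε : 0 < ε) :
    ∃ n₀ : ℕ, ∀ n ≥ n₀, ∀ T : Finset Λ, T.card ≤ 4 * n → ∃ r : ℕ, ∃ b : Λ → Γ,
      D * (Nat.log 2 n + 2) + 1 ≤ r ∧
      (∀ l ∈ T, ∀ l', wordLength (S' : Set Λ) (l⁻¹ * l') ≤ d →
        wordLength (S : Set Γ) ((b l)⁻¹ * b l') ≤ r) ∧
      ∀ l ∈ T, ∀ l', wordLength (S : Set Γ) ((b l)⁻¹ * b l') ≤ 4 * r →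
        (wordLength (S' : Set Λ) (l⁻¹ * l') : ℝ) ≤ ε * n := by
  classical
  have := countable_of_closure_eq_top hS
  have := countable_of_closure_eq_top hS'
  have hp : 0 < p := hq.trans hpq
  obtain ⟨F, hF⟩ := hcobounded
  set B := (unitBall S).card with hB
  have hB1 : 1 ≤ B := Finset.card_pos.2 ⟨1, one_mem_unitBall S⟩
  have hB0 : (0 : ℝ) < B := by exact_mod_cast hB1
  have hlogB : 0 ≤ Real.log B := Real.log_natCast_nonneg B
  obtain ⟨C₁, hC₁, h₁⟩ := exists_sum_tail_le_rpow hcoupling.fundamental_left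
    hcoupling.measurable_left (show 0 < 1 + 1 / q by positivity) hψ hS (unitBall S' ^ d)
  -- The rate 4 log B + 1 beats the bound B^(4r) on the size of the ball of radius 4r in Γ and
  -- leaves exp(-r).
  obtain ⟨L, C₂, hL, hC₂, h₂⟩ := exists_sum_tail_le_exp hcoupling.fundamental_right
    hcoupling.measurable_right hp hφ (unitBall S) (M := 4 * Real.log B + 1) (by positivity)
  have hm₀ : 0 < (μ XΓ).toReal := ENNReal.toReal_pos
    (hcoupling.fundamental_left.measure_ne_zero hcoupling.ne_zero) hcoupling.finite_left.ne
  obtain ⟨n₀, hn₀⟩ := exists_scale hq hpq (C₃ := 2 * F.sup (wordLength (S' : Set Λ))) (D := D) hC₁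
    (show 0 ≤ F.card * C₂ by positivity) hL hm₀ hε
  refine ⟨n₀, fun n hn T hT => ?_⟩
  obtain ⟨r, hr1, hrD, hrm, hrε⟩ := hn₀ n hn
  have hlt : T.card * (∑ s ∈ unitBall S' ^ d, μ (XΓ ∩ tailSet (S : Set Γ) XΓ s⁻¹ r) +
      (B ^ (4 * r) : ℕ) * (F.card * ∑ s ∈ unitBall S,
        μ (XΛ ∩ tailSet (S' : Set Λ) XΛ s⁻¹ (L * (r : ℝ) ^ (1 / p))))) < μ XΓ := by
    have hexp : ((B ^ (4 * r) : ℕ) : ℝ) * Real.exp (-((4 * Real.log B + 1) * r)) =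
        Real.exp (-r) := by
      have : ((B ^ (4 * r) : ℕ) : ℝ) = Real.exp (Real.log B * (4 * r : ℕ)) := by
        rw [Real.exp_mul, Real.exp_log hB0, Real.rpow_natCast]; push_cast; rfl
      rw [this, ← Real.exp_add]
      congr 1; push_cast; ring
    calc _ ≤ ENNReal.ofReal (4 * n) * (ENNReal.ofReal (C₁ * (r : ℝ) ^ (-(1 + 1 / q))) +
          ENNReal.ofReal (B ^ (4 * r) : ℕ) * (ENNReal.ofReal F.card *
            ENNReal.ofReal (C₂ * Real.exp (-((4 * Real.log B + 1) * r))))) := by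
          rw [ENNReal.ofReal_natCast, ENNReal.ofReal_natCast]
          refine mul_le_mul' ?_ (add_le_add (h₁ r hr1) (mul_le_mul' le_rfl
            (mul_le_mul' le_rfl (h₂ r))))
          rw [← ENNReal.ofReal_natCast]
          exact ENNReal.ofReal_le_ofReal (by exact_mod_cast hT)
      _ = ENNReal.ofReal (4 * n * (C₁ * (r : ℝ) ^ (-(1 + 1 / q)) +
            F.card * C₂ * Real.exp (-r))) := by
          rw [← ENNReal.ofReal_mul (by positivity), ← ENNReal.ofReal_mul (by positivity),
            ← ENNReal.ofReal_add (by positivity) (by positivity),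
            ← ENNReal.ofReal_mul (by positivity), ← hexp]
          congr 1; ring
      _ < ENNReal.ofReal (μ XΓ).toReal := (ENNReal.ofReal_lt_ofReal_iff hm₀).2 hrm
      _ = μ XΓ := ENNReal.ofReal_toReal hcoupling.finite_left.ne
  obtain ⟨b, hb₁, hb₂⟩ := exists_map_of_measure_tails_lt hcoupling hF hS hS' hlt
  refine ⟨r, b, hrD, hb₁, fun l hl l' hll' => (hb₂ l hl l' hll').trans ?_⟩
  push_cast
  exact hrε

/-- On large scales, coarse geodesics of `Λ` are sublinearly close to coarse paths with the same end
points. -/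
theorem exists_wordLength_le_of_coarsePaths {p q : ℝ} (hq : 0 < q) (hpq : q < p)
    (hcoupling : IsMECoupling Γ Λ μ XΓ XΛ) (hcobounded : IsCobounded Λ XΓ XΛ)
    {S : Finset Γ} {S' : Finset Λ} (hS : Subgroup.closure (S : Set Γ) = ⊤)
    (hhyp : IsRipsHyperbolic (GraphRealization (SimpleGraph.mulCayley (S : Set Γ))
      (mulCayley_connected hS)))
    (hS' : Subgroup.closure (S' : Set Λ) = ⊤)
    (hφ : ∀ g : Γ, ∃ c : ℝ, 0 < c ∧ ∫⁻ x in XΛ, ENNReal.ofReal (Real.exp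
      ((wordLength (S' : Set Λ) (couplingCocycle Λ XΛ g x) / c) ^ p)) ∂μ < ∞)
    (hψ : IsPhiIntegrable Λ Γ (fun t => t ^ (1 + 1 / q)) μ XΓ) {ε : ℝ} (hε : 0 < ε) :
    ∃ n₀ : ℕ, ∀ n ≥ n₀, ∀ k ≤ n, ∀ l ≤ n, ∀ u v : ℕ → Λ, u 0 = v 0 → u k = v l →
      (∀ i < k, wordLength (S' : Set Λ) ((u i)⁻¹ * u (i + 1)) ≤ 3) →
      (∀ i < l, wordLength (S' : Set Λ) ((v i)⁻¹ * v (i + 1)) ≤ 3) →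
      (∀ i j, i ≤ j → j ≤ k → j - i ≤ wordLength (S' : Set Λ) ((u i)⁻¹ * u j) + 3) →
      ∀ i ≤ k, ∃ j ≤ l, (wordLength (S' : Set Λ) ((u i)⁻¹ * v j) : ℝ) ≤ ε * n := by
  classical
  obtain ⟨hgeo, δ, hδ0, hδ⟩ := hhyp
  -- The final estimate is 3(εn/5 + 3) + εn/5: a step of u has length at most 3, and u is geodesic
  -- up to 3. The fifth share of εn absorbs the constant 9.
  obtain ⟨n₀, hn₀⟩ := exists_map_sublinear hq hpq hcoupling hcobounded hS hS' hφ hψ 3 δ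
    (show 0 < ε / 5 by positivity)
  refine ⟨max n₀ (max 1 ⌈9 / (ε / 5)⌉₊), fun n hn k hk l hl u v h0 h1 hu hv hgeod i hi => ?_⟩
  have hnn₀ : n₀ ≤ n := (le_max_left _ _).trans hn
  have hn1 : 1 ≤ n := ((le_max_left _ _).trans (le_max_right _ _)).trans hn
  have hn9 : 9 ≤ ε / 5 * n := by
    have h2 : ⌈9 / (ε / 5)⌉₊ ≤ n := ((le_max_right _ _).trans (le_max_right _ _)).trans hn
    have h3 := Nat.ceil_le.1 h2
    rwa [div_le_iff₀ (by positivity), mul_comm] at h3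
  set T : Finset Λ := (Finset.range (k + 1)).image u ∪ (Finset.range (l + 1)).image v with hT
  have huT : ∀ i ≤ k, u i ∈ T := fun i hi =>
    Finset.mem_union_left _ (Finset.mem_image_of_mem _ (Finset.mem_range.2 (by omega)))
  have hvT : ∀ i ≤ l, v i ∈ T := fun i hi =>
    Finset.mem_union_right _ (Finset.mem_image_of_mem _ (Finset.mem_range.2 (by omega)))
  have hTcard : T.card ≤ 4 * n := by
    have c1 := Finset.card_union_le ((Finset.range (k + 1)).image u)
      ((Finset.range (l + 1)).image v)
    have c2 := Finset.card_image_le (s := Finset.range (k + 1)) (f := u)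
    have c3 := Finset.card_image_le (s := Finset.range (l + 1)) (f := v)
    rw [Finset.card_range] at c2 c3
    rw [← hT] at c1
    omega
  obtain ⟨r, b, hr, hb₁, hb₂⟩ := hn₀ n hnn₀ T hTcard
  have hdist : ∀ g h : Γ, dist (GraphRealization.vertex (mulCayley_connected hS) g)
      (GraphRealization.vertex (mulCayley_connected hS) h) =
      wordLength (S : Set Γ) (g⁻¹ * h) := fun g h => by
    rw [GraphRealization.dist_vertex_vertex, mulCayley_dist_eq_wordLength hS]
  have hpow : n ≤ 2 ^ (Nat.log 2 n + 1) := (Nat.lt_pow_succ_log_self one_lt_two n).le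
  obtain ⟨i₁, hi₁, i₂, hi₂, hii₂, j, hj, hclose, hclose'⟩ := exists_backtrack_close hgeo hδ0 hδ
    (r := r) (m := Nat.log 2 n + 1) (k := k) (l := l)
    (u := fun i => GraphRealization.vertex (mulCayley_connected hS) (b (u i)))
    (v := fun i => GraphRealization.vertex (mulCayley_connected hS) (b (v i)))
    (by push_cast; linarith) (hk.trans hpow) (hl.trans hpow)
    (fun i hi => by rw [hdist]; exact_mod_cast hb₁ _ (huT i hi.le) _ (hu i hi))
    (fun i hi => by rw [hdist]; exact_mod_cast hb₁ _ (hvT i hi.le) _ (hv i hi))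
    (by simp only [h0]) (by simp only [h1]) hi
  rw [hdist] at hclose hclose'
  have k₁ := hb₂ _ (huT i₁ (hi₁.trans hi)) _ (by exact_mod_cast hclose)
  have k₂ := hb₂ _ (huT i₁ (hi₁.trans hi)) _ (by exact_mod_cast hclose')
  -- Almost geodesicity of u turns closeness of `u i₁` and `u i₂` into closeness of the times, which
  -- traps the time i between them.
  have k₃ : ((i₂ - i₁ : ℕ) : ℝ) ≤ wordLength (S' : Set Λ) ((u i₁)⁻¹ * u i₂) + 3 := by
    exact_mod_cast hgeod i₁ i₂ (by omega) hi₂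
  have k₄ : (wordLength (S' : Set Λ) ((u i₁)⁻¹ * u i) : ℝ) ≤ 3 * ((i₂ - i₁ : ℕ) : ℝ) := by
    have := wordLength_inv_mul_le_of_steps hS' i hi₁ fun t ht => hu t (by omega)
    exact_mod_cast this.trans (by omega)
  have k₅ : (wordLength (S' : Set Λ) ((u i)⁻¹ * v j) : ℝ) ≤
      wordLength (S' : Set Λ) ((u i₁)⁻¹ * u i) + wordLength (S' : Set Λ) ((u i₁)⁻¹ * v j) := by
    rw [← wordLength_inv hS' ((u i₁)⁻¹ * u i)]
    have := wordLength_mul_le hS' ((u i₁)⁻¹ * u i)⁻¹ ((u i₁)⁻¹ * v j)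
    rw [show ((u i₁)⁻¹ * u i)⁻¹ * ((u i₁)⁻¹ * v j) = (u i)⁻¹ * v j by group] at this
    exact_mod_cast this
  exact ⟨j, hj, by linarith⟩

end Main

/-- Passage from coarse paths of vertices to chains in the Cayley graph. -/
theorem geodesicsNearChains_of_coarsePaths {Λ : Type*} [Group Λ] {S : Set Λ}
    (hS : Subgroup.closure S = ⊤) {n₀ : ℕ}
    (h : ∀ n ≥ n₀, ∀ k ≤ n, ∀ l ≤ n, ∀ u v : ℕ → Λ, u 0 = v 0 → u k = v l →
      (∀ i < k, wordLength S ((u i)⁻¹ * u (i + 1)) ≤ 3) →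
      (∀ i < l, wordLength S ((v i)⁻¹ * v (i + 1)) ≤ 3) →
      (∀ i j, i ≤ j → j ≤ k → j - i ≤ wordLength S ((u i)⁻¹ * u j) + 3) →
      ∀ i ≤ k, ∃ j ≤ l, (wordLength S ((u i)⁻¹ * v j) : ℝ) ≤ 1 / 1000 * n) :
    GeodesicsNearChains (GraphRealization (SimpleGraph.mulCayley S) (mulCayley_connected hS))
      (1 / 301) (max n₀ 3000) := by
  intro n hn a b A E hA hab k hk hch m hm
  obtain ⟨c, c0, c1, hc, rfl⟩ := hA
  obtain ⟨t, ht, rfl⟩ := hm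
  obtain ⟨x, x0, xk, hx, hxE⟩ := hch
  have hn₀ : (n₀ : ℝ) ≤ n := (le_max_left _ _).trans hn
  have hn3 : (3000 : ℝ) ≤ n := (le_max_right _ _).trans hn
  choose near hnear using GraphRealization.exists_dist_vertex_le (hG := mulCayley_connected hS)
  have hdist : ∀ y z, |(wordLength S ((near y)⁻¹ * near z) : ℝ) - dist y z| ≤ 2 := by
    intro y z
    have e : dist (GraphRealization.vertex (mulCayley_connected hS) (near y))
        (GraphRealization.vertex (mulCayley_connected hS) (near z)) =
        wordLength S ((near y)⁻¹ * near z) := by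
      rw [GraphRealization.dist_vertex_vertex, mulCayley_dist_eq_wordLength hS]
    rw [← e]
    have h1 := hnear y
    have h2 := hnear z
    rw [abs_le]
    constructor
    · have := dist_triangle4_right y z (GraphRealization.vertex (mulCayley_connected hS) (near y))
        (GraphRealization.vertex (mulCayley_connected hS) (near z))
      linarith
    · have := dist_triangle4 (GraphRealization.vertex (mulCayley_connected hS) (near y)) y z
        (GraphRealization.vertex (mulCayley_connected hS) (near z))
      rw [dist_comm y] at h1
      linarith
  have hstep : ∀ y z, dist y z ≤ 1 → wordLength S ((near y)⁻¹ * near z) ≤ 3 := by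
    intro y z hyz
    have := (abs_le.1 (hdist y z)).2
    have h3 : (wordLength S ((near y)⁻¹ * near z) : ℝ) ≤ 3 := by linarith
    exact_mod_cast h3
  set d := dist a b with hd
  have hd0 : 0 ≤ d := dist_nonneg
  have hmem : ∀ i : ℕ, min (i : ℝ) d ∈ Icc 0 d := fun i =>
    ⟨le_min (Nat.cast_nonneg _) hd0, min_le_right _ _⟩
  have hfloor : ⌊t⌋₊ ≤ ⌈d⌉₊ := (Nat.floor_le_floor ht.2).trans (Nat.floor_le_ceil d)
  have hNn : (⌈n⌉₊ : ℝ) < n + 1 := Nat.ceil_lt_add_one (by linarith)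
  -- The geodesic is sampled at integer times truncated at d, so the last sample is b. Rounding to
  -- vertices changes distances by at most 2: unit steps become 3, and with the truncated last step
  -- the geodesic defect is also 3.
  obtain ⟨j, hj, hjle⟩ := h ⌈n⌉₊ (by exact_mod_cast hn₀.trans (Nat.le_ceil n)) ⌈d⌉₊
    (Nat.ceil_le_ceil hab) k (by exact_mod_cast hk.trans (Nat.le_ceil n))
    (fun i => near (c (min i d))) (fun i => near (x i)) (by simp [c0, x0, hd0])
    (by rw [min_eq_right (Nat.le_ceil d), c1, xk])
    (fun i _ => hstep _ _ (by
      rw [hc _ (hmem i) _ (hmem (i + 1)), abs_le]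
      push_cast
      constructor <;> rcases min_cases (i : ℝ) d with h | h <;>
        rcases min_cases ((i : ℝ) + 1) d with h' | h' <;> rw [h.1, h'.1] <;> linarith))
    (fun i hi => hstep _ _ (hx i hi))
    (fun i j hij hj => by
      have h1 := (abs_le.1 (hdist (c (min i d)) (c (min j d)))).1
      rw [hc _ (hmem i) _ (hmem j)] at h1
      have hi' : ((i : ℕ) : ℝ) ≤ j := by exact_mod_cast hij
      have hj' : (j : ℝ) ≤ d + 1 :=
        le_trans (by exact_mod_cast hj) (Nat.ceil_lt_add_one hd0).le
      have h2 := neg_abs_le (min (i : ℝ) d - min (j : ℝ) d)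
      have h3 : (j : ℝ) - 1 ≤ min (j : ℝ) d := le_min (by linarith) (by linarith)
      have h4 := min_le_left (i : ℝ) d
      have h5 : (j : ℝ) ≤
          wordLength S ((near (c (min i d)))⁻¹ * near (c (min j d))) + 3 + i := by linarith
      have h6 : j ≤ wordLength S ((near (c (min i d)))⁻¹ * near (c (min j d))) + 3 + i := by
        exact_mod_cast h5
      omega)
    ⌊t⌋₊ hfloor
  -- The total error is at most 1 + 2 + (n + 1)/1000, below n/301 for n ≥ 3000.
  refine ⟨x j, hxE j hj, ?_⟩
  have hft := Nat.floor_le ht.1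
  have hft' := Nat.lt_floor_add_one t
  have e1 : dist (c t) (c (min (⌊t⌋₊ : ℝ) d)) ≤ 1 := by
    rw [hc _ ht _ (hmem _), min_eq_left (hft.trans ht.2), abs_le]
    constructor <;> linarith
  have e2 := (abs_le.1 (hdist (c (min (⌊t⌋₊ : ℝ) d)) (x j))).1
  have e3 := dist_triangle (c t) (c (min (⌊t⌋₊ : ℝ) d)) (x j)
  linarith

end

theorem mainTheorem7 {Γ Λ : Type*} [Group Γ] [Group Λ] (hΓ : IsHyperbolicGroup Γ)
    (hΛ : Group.FG Λ) (p q : ℝ) (hq : 0 < q) (hpq : q < p)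
    {Ω : Type*} [MeasurableSpace Ω] [StandardBorelSpace Ω] [MulAction Γ Ω] [MulAction Λ Ω]
    [SMulCommClass Γ Λ Ω] [MeasurableConstSMul Γ Ω] [MeasurableConstSMul Λ Ω]
    (μ : Measure Ω) [SMulInvariantMeasure Γ Ω μ] [SMulInvariantMeasure Λ Ω μ] (XΓ XΛ : Set Ω)
    (hcoupling : IsMECoupling Γ Λ μ XΓ XΛ)
    (hcobounded : IsCobounded Λ XΓ XΛ)
    (hφ : IsPhiIntegrable Γ Λ (fun t => Real.exp (t ^ p)) μ XΛ)
    (hψ : IsPhiIntegrable Λ Γ (fun t => t ^ (1 + 1 / q)) μ XΓ) :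
    IsHyperbolicGroup Λ := by
  obtain ⟨S, hS, hhyp⟩ := hΓ
  obtain ⟨S', hS', hφ⟩ := hφ
  -- The generating set of Λ is the one supplied with the exponential moment, that of Γ the one
  -- supplied with hyperbolicity; a change of generators is needed only for the moment of order 1 +
  -- 1/q.
  obtain ⟨n₀, hn₀⟩ := exists_wordLength_le_of_coarsePaths hq hpq hcoupling hcobounded hS hhyp hS'
    hφ hψ (show (0 : ℝ) < 1 / 1000 by norm_num)
  exact ⟨S', hS', isRipsHyperbolic_of_geodesicsNearChains
    (GraphRealization.isGeodesicSpace _ _) (by norm_num)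
    (geodesicsNearChains_of_coarsePaths hS' hn₀)⟩
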